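/- Let $\mathbf k$ be a field. All vector spaces are over $\mathbf k$, and for a vector space $W$ we write $\operatorname{Sym}^2W^\vee$ for the space of symmetric bilinear forms on $W$. **GM data.** A GM data $(W,V_6,V_5,L,\mu,\mathbf q,\varepsilon)$ consists of a finite-dimensional vector space $W$ (of any dimension), a vector space $V_6$ of dimension $6$, a hyperplane $V_5\subset V_6$, a vector space $L$ of dimension $1$, linear maps $\mu\colon L\otimes W\to\bigwedge^2V_5$ and $\mathbf q\colon V_6\to\operatorname{Sym}^2W^\vee$, and an isomorphism $\varepsilon\colon\bigwedge^5V_5\to L^{\otimes2}$, such that for all $v\in V_5$, $w,w'\in W$, $l,l'\in L$ $$\mathbf q(v)(w,w')\; l\otimes l'=\varepsilon\bigl(v\wedge\mu(l\otimes w)\wedge\mu(l'\otimes w')\bigr).$$ An isomorphism between such a data and $(W',V_6',V_5',L',\mu',\mathbf q',\varepsilon')$ is a triple of linear isomorphisms $\varphi_W\colon W\to W'$, $\varphi_V\colon V_6\to V_6'$, $\varphi_L\colon L\to L'$ with $\varphi_V(V_5)=V_5'$, $\varepsilon'\circ\bigwedge^5\varphi_V=\varphi_L^{\otimes2}\circ\varepsilon$,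 $\mathbf q'(\varphi_V(v))(\varphi_W(w),\varphi_W(w'))=\mathbf q(v)(w,w')$ and $\bigwedge^2\varphi_V\circ\mu=\mu'\circ(\varphi_L\otimes\varphi_W)$. Let $W_1\subset W$ be the kernel of $\mu$, that is, $W_1=\{w:\mu(l\otimes w)=0\ \forall l\in L\}$. The data is *ordinary* if $W_1=0$; it is *special* if $\dim W_1=1$ and $\mathbf q(v)(w,w)\neq0$ for all $v\in V_6\smallsetminus V_5$ and all nonzero $w\in W_1$; it is *lci* if it is ordinary or special. For an lci GM data, let $W_0\subset W$ be the orthogonal of $W_1$ with respect to all forms $\mathbf q(v)$, $v\in V_6$; it is the unique complement of $W_1$ for which every $\mathbf q(v)$ is the sum of a form on $W_0$ and a form on $W_1$. **Lagrangian data.** A Lagrangian data $(V_6,V_5,A)$ consists of a vector space $V_6$ of dimension $6$, a hyperplane $V_5\subset V_6$, and a subspace $A\subset\bigwedge^3V_6$ which is Lagrangian for the $\bigwedge^6V_6$-valued symplectic form given by wedge product. An isomorphism $(V_6,V_5,A)\to(V_6',V_5',A')$ is a linear isomorphism $\varphi\colon V_6\to V_6'$ with $\varphi(V_5)=V_5'$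 and $(\bigwedge^3\varphi)(A)=A'$. An extended Lagrangian data $(V_6,V_5,A,A_1)$ is a Lagrangian data together with a subspace $A_1\subset\mathbf k\oplus(V_6/V_5)^\vee$ which is Lagrangian for the $(V_6/V_5)^\vee$-valued symplectic form $((x,x'),(y,y'))\mapsto yx'-xy'$. An isomorphism of extended Lagrangian data is an isomorphism $\varphi$ of Lagrangian data together with $t\in\mathbf k^\times$ such that $A_1$ is sent to $A_1'$ by the map $\mathbf k\oplus(V_6/V_5)^\vee\to\mathbf k\oplus(V_6'/V_5')^\vee$ which is the identity on $\mathbf k$ and $t$ times the isomorphism induced by $\varphi$ on the second summand. We write $A_1=\infty$ if $A_1=\mathbf k\oplus0$ and $A_1=0$ if $A_1=0\oplus(V_6/V_5)^\vee$. **Construction.** For an lci GM data, consider the linear maps $$f_2\colon\textstyle\bigwedge^3V_5\oplus(V_6\otimes L\otimes W_0)\to\operatorname{Hom}(L\otimes W_0,L^{\otimes2})\simeq W_0^\vee\otimes L,\qquad f_3\colon\bigwedge^3V_5\oplus(V_6\otimes L\otimes W_0)\to\bigwedge^3V_6,$$ $$f_2(\xi,v\otimes l\otimes w)(l'\otimes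 w')=\varepsilon(\xi\wedge\mu(l'\otimes w'))+\mathbf q(v)(w,w')\,l\otimes l',\qquad f_3(\xi,v\otimes l\otimes w)=\xi+v\wedge\mu(l\otimes w),$$ and set $A:=f_3(\operatorname{Ker}f_2)$. Given moreover an injective linear map $\mu_1\colon W_1\to\mathbf k$ and an isomorphism $\kappa\colon L\to(V_6/V_5)^\vee$, consider $$g_2\colon L\oplus(V_6\otimes L\otimes W_1)\to W_1^\vee\otimes L,\qquad g_3\colon L\oplus(V_6\otimes L\otimes W_1)\to\mathbf k\oplus(V_6/V_5)^\vee,$$ $$g_2(x',v\otimes l\otimes w)(w')=\mu_1(w')\,x'+\mathbf q(v)(w,w')\,l,\qquad g_3(x',v\otimes l\otimes w)=\bigl(\kappa(l)(\bar v)\,\mu_1(w),\kappa(x')\bigr),$$ where $\bar v$ is the class of $v$ in $V_6/V_5$, and set $A_1:=g_3(\operatorname{Ker}g_2)$. **Theorem.** (a) For every lci GM data, $A$ is Lagrangian, and $(W,V_6,V_5,L,\mu,\mathbf q,\varepsilon)\mapsto(V_6,V_5,A)$, $(\varphi_W,\varphi_V,\varphi_L)\mapsto\varphi_V$, defines a functor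 from the groupoid of lci GM data to the groupoid of Lagrangian data. It induces a bijection between the set of isomorphism classes of ordinary GM data and the set of isomorphism classes of Lagrangian data. (b) If $\mathbf k$ is quadratically closed (every element of $\mathbf k$ is a square), this extends as follows. For every lci GM data and all choices of $\mu_1$ and $\kappa$, the subspace $A_1$ is Lagrangian and $A_1\ne\infty$; moreover $A_1=0$ if and only if the GM data is ordinary. The isomorphism class of $(V_6,V_5,A,A_1)$ depends only on the isomorphism class of the GM data, and not on $\mu_1$ and $\kappa$; it gives a bijection between the set of isomorphism classes of lci GM data and the set of isomorphism classes of extended Lagrangian data with $A_1\neq\infty$, which, followed by forgetting $A_1$, is the map on isomorphism classes induced by the functor in (a). -/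

import Mathlib

universe u

open CategoryTheory TensorProduct

noncomputable section

namespace GushelMukai

/-! ### Exterior powers -/

section Exterior

variable {k : Type u} [Field k]

/-- The wedge product `⋀^p V × ⋀^q V → ⋀^r V`, where `p + q = r`. -/
def wedge (V : Type u) [AddCommGroup V] [Module k V] (p q r : ℕ) (h : p + q = r) :
    ⋀[k]^p V →ₗ[k] ⋀[k]^q V →ₗ[k] ⋀[k]^r V :=
  LinearMap.mk₂ k
    (fun x y => ⟨(x : ExteriorAlgebra k V) * (y : ExteriorAlgebra k V), by
      subst h
      exact SetLike.mul_mem_graded x.2 y.2⟩)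
    (fun _ _ _ => Subtype.ext (add_mul _ _ _))
    (fun _ _ _ => Subtype.ext (smul_mul_assoc _ _ _))
    (fun _ _ _ => Subtype.ext (mul_add _ _ _))
    (fun _ _ _ => Subtype.ext (mul_smul_comm _ _ _))

/-- The wedge product `V × ⋀^p V → ⋀^r V` with a vector, where `1 + p = r`. -/
def vecWedge (V : Type u) [AddCommGroup V] [Module k V] (p r : ℕ) (h : 1 + p = r) :
    V →ₗ[k] ⋀[k]^p V →ₗ[k] ⋀[k]^r V :=
  (wedge V 1 p r h).comp (exteriorPower.oneEquiv k V).symm.toLinearMap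

end Exterior

/-! ### Lagrangian subspaces -/

section Lagrangian

variable {k : Type u} [Field k]

/-- A subspace is Lagrangian for a bilinear form (with values in any vector space) if it is equal
to its own orthogonal. It is only used for nondegenerate alternating forms with values in a line. -/
def IsLagrangian {V N : Type u} [AddCommGroup V] [Module k V] [AddCommGroup N] [Module k N]
    (ω : V →ₗ[k] V →ₗ[k] N) (A : Submodule k V) : Prop :=
  ∀ x, x ∈ A ↔ ∀ y ∈ A, ω x y = 0

/-- The `L`-valued symplectic form `((x, x'), (y, y')) ↦ y x' - x y'` on `k ⊕ L`. -/
def oddForm (L : Type u) [AddCommGroup L] [Module k L] : (k × L) →ₗ[k] (k × L) →ₗ[k] L :=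
  LinearMap.mk₂ k (fun a b => b.1 • a.2 - a.1 • b.2)
    (fun _ _ _ => by simp only [Prod.fst_add, Prod.snd_add]; module)
    (fun _ _ _ => by simp only [Prod.smul_fst, Prod.smul_snd, smul_eq_mul]; module)
    (fun _ _ _ => by simp only [Prod.fst_add, Prod.snd_add]; module)
    (fun _ _ _ => by simp only [Prod.smul_fst, Prod.smul_snd, smul_eq_mul]; module)

end Lagrangian

/-! ### Isomorphism classes -/

/-- The isomorphism classes of objects of a category. -/
abbrev IsoClasses (C : Type*) [Category C] := Quotient (isIsomorphicSetoid C)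

/-- The isomorphism class of an object. -/
abbrev isoClass {C : Type*} [Category C] (X : C) : IsoClasses C :=
  Quotient.mk (isIsomorphicSetoid C) X

/-- The map induced by a functor on isomorphism classes. -/
def mapIsoClasses {C D : Type*} [Category C] [Category D] (F : C ⥤ D) :
    IsoClasses C → IsoClasses D :=
  Quotient.map F.obj fun _ _ ⟨e⟩ => ⟨F.mapIso e⟩

/-! ### GM data -/

/-- A GM data `(W, V₆, V₅, L, μ, q, ε)` over `k`. Its dimension is the integer `dim W - 5`.
An element of `Sym² W^∨` is a symmetric bilinear form on `W`. -/
structure GMData (k : Type u) [Field k] where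
  W : Type u
  V₆ : Type u
  L : Type u
  [instAddW : AddCommGroup W]
  [instModW : Module k W]
  [instFinW : FiniteDimensional k W]
  [instAddV : AddCommGroup V₆]
  [instModV : Module k V₆]
  [instAddL : AddCommGroup L]
  [instModL : Module k L]
  V₅ : Submodule k V₆
  finrank_V₆ : Module.finrank k V₆ = 6
  finrank_V₅ : Module.finrank k V₅ = 5
  finrank_L : Module.finrank k L = 1
  μ : L ⊗[k] W →ₗ[k] ⋀[k]^2 V₅
  q : V₆ →ₗ[k] W →ₗ[k] W →ₗ[k] k
  ε : ⋀[k]^5 V₅ ≃ₗ[k] L ⊗[k] L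
  q_symm : ∀ v w₁ w₂, q v w₁ w₂ = q v w₂ w₁
  q_plucker : ∀ (v : V₅) (l₁ l₂ : L) (w₁ w₂ : W),
    q v w₁ w₂ • (l₁ ⊗ₜ[k] l₂) =
      ε (vecWedge V₅ 4 5 rfl v (wedge V₅ 2 2 4 rfl (μ (l₁ ⊗ₜ w₁)) (μ (l₂ ⊗ₜ w₂))))

attribute [instance] GMData.instAddW GMData.instModW GMData.instFinW GMData.instAddV
  GMData.instModV GMData.instAddL GMData.instModL

section Restrict

variable {k : Type u} [Field k] {V V' V'' : Type u} [AddCommGroup V] [Module k V]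
  [AddCommGroup V'] [Module k V'] [AddCommGroup V''] [Module k V'']

/-- The linear map `⋀^p U → ⋀^p U'` induced by a linear isomorphism `φ` with `φ(U) = U'`. -/
def wedgeRestrict (p : ℕ) (φ : V ≃ₗ[k] V') (U : Submodule k V) (U' : Submodule k V')
    (h : U.map (φ : V →ₗ[k] V') = U') : ⋀[k]^p U →ₗ[k] ⋀[k]^p U' :=
  exteriorPower.map p (φ.ofSubmodules U U' h : U →ₗ[k] U')

lemma wedgeRestrict_refl (p : ℕ) (U : Submodule k V)
    (h : U.map (LinearEquiv.refl k V : V →ₗ[k] V) = U) :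
    wedgeRestrict p (LinearEquiv.refl k V) U U h = LinearMap.id := by
  rw [wedgeRestrict, ← exteriorPower.map_id]
  rfl

lemma wedgeRestrict_trans (p : ℕ) (φ : V ≃ₗ[k] V') (ψ : V' ≃ₗ[k] V'') (U : Submodule k V)
    (U' : Submodule k V') (U'' : Submodule k V'') (h h' h'') (x : ⋀[k]^p U) :
    wedgeRestrict p (φ.trans ψ) U U'' h'' x =
      wedgeRestrict p ψ U' U'' h' (wedgeRestrict p φ U U' h x) := by
  simp only [wedgeRestrict]
  rw [← LinearMap.comp_apply, ← exteriorPower.map_comp]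
  rfl

lemma map_symm_eq {φ : V ≃ₗ[k] V'} {U : Submodule k V} {U' : Submodule k V'}
    (h : U.map (φ : V →ₗ[k] V') = U') : U'.map (φ.symm : V' →ₗ[k] V) = U := by
  subst h
  ext x
  simp

lemma map_trans_eq {φ : V ≃ₗ[k] V'} {ψ : V' ≃ₗ[k] V''} {U : Submodule k V} {U' : Submodule k V'}
    {U'' : Submodule k V''} (h : U.map (φ : V →ₗ[k] V') = U')
    (h' : U'.map (ψ : V' →ₗ[k] V'') = U'') :
    U.map ((φ.trans ψ : V ≃ₗ[k] V'') : V →ₗ[k] V'') = U'' := by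
  subst h h'
  ext x
  simp

lemma wedgeRestrict_self_symm (p : ℕ) (φ : V ≃ₗ[k] V') (U : Submodule k V)
    (U' : Submodule k V') (h h') (x : ⋀[k]^p U') :
    wedgeRestrict p φ U U' h (wedgeRestrict p φ.symm U' U h' x) = x := by
  have hc : U'.map ((φ.symm.trans φ : V' ≃ₗ[k] V') : V' →ₗ[k] V') = U' := map_trans_eq h' h
  rw [← wedgeRestrict_trans p φ.symm φ U' U U' h' h hc]
  have := wedgeRestrict_refl (k := k) p U' (by simp)
  simp only [LinearEquiv.symm_trans_self]
  rw [this]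
  rfl

lemma wedgeRestrict_symm_self (p : ℕ) (φ : V ≃ₗ[k] V') (U : Submodule k V)
    (U' : Submodule k V') (h h') (x : ⋀[k]^p U) :
    wedgeRestrict p φ.symm U' U h' (wedgeRestrict p φ U U' h x) = x :=
  wedgeRestrict_self_symm p φ.symm U' U h' h x

end Restrict

namespace GMData

variable {k : Type u} [Field k]

/-- An isomorphism of GM data. -/
@[ext]
structure Iso (D E : GMData k) where
  φW : D.W ≃ₗ[k] E.W
  φV : D.V₆ ≃ₗ[k] E.V₆
  φL : D.L ≃ₗ[k] E.L
  map_V₅ : D.V₅.map (φV : D.V₆ →ₗ[k] E.V₆) = E.V₅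
  map_ε : ∀ x, E.ε (wedgeRestrict 5 φV D.V₅ E.V₅ map_V₅ x) =
    TensorProduct.map (φL : D.L →ₗ[k] E.L) (φL : D.L →ₗ[k] E.L) (D.ε x)
  map_q : ∀ v w₁ w₂, E.q (φV v) (φW w₁) (φW w₂) = D.q v w₁ w₂
  map_μ : ∀ x, wedgeRestrict 2 φV D.V₅ E.V₅ map_V₅ (D.μ x) =
    E.μ (TensorProduct.map (φL : D.L →ₗ[k] E.L) (φW : D.W →ₗ[k] E.W) x)

/-- The identity isomorphism. -/
def Iso.refl (D : GMData k) : Iso D D where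
  φW := LinearEquiv.refl k D.W
  φV := LinearEquiv.refl k D.V₆
  φL := LinearEquiv.refl k D.L
  map_V₅ := by simp
  map_ε x := by rw [wedgeRestrict_refl]; simp
  map_q _ _ _ := rfl
  map_μ x := by rw [wedgeRestrict_refl]; simp

/-- The composition of isomorphisms. -/
def Iso.trans {D E F : GMData k} (f : Iso D E) (g : Iso E F) : Iso D F where
  φW := f.φW.trans g.φW
  φV := f.φV.trans g.φV
  φL := f.φL.trans g.φL
  map_V₅ := map_trans_eq f.map_V₅ g.map_V₅
  map_ε x := by
    rw [wedgeRestrict_trans 5 f.φV g.φV D.V₅ E.V₅ F.V₅ f.map_V₅ g.map_V₅, g.map_ε, f.map_ε,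
      LinearEquiv.coe_trans, TensorProduct.map_comp]
    rfl
  map_q v w₁ w₂ := by
    simp only [LinearEquiv.trans_apply]
    rw [g.map_q, f.map_q]
  map_μ x := by
    rw [wedgeRestrict_trans 2 f.φV g.φV D.V₅ E.V₅ F.V₅ f.map_V₅ g.map_V₅, f.map_μ, g.map_μ,
      LinearEquiv.coe_trans, LinearEquiv.coe_trans, TensorProduct.map_comp]
    rfl

lemma tensor_map_symm {M N M' N' : Type u} [AddCommGroup M] [Module k M] [AddCommGroup N]
    [Module k N] [AddCommGroup M'] [Module k M'] [AddCommGroup N'] [Module k N']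
    (f : M ≃ₗ[k] M') (g : N ≃ₗ[k] N') (x : M' ⊗[k] N') :
    TensorProduct.map (f : M →ₗ[k] M') (g : N →ₗ[k] N')
      (TensorProduct.map (f.symm : M' →ₗ[k] M) (g.symm : N' →ₗ[k] N) x) = x := by
  rw [← LinearMap.comp_apply, ← TensorProduct.map_comp]
  simp

/-- The inverse of an isomorphism. -/
def Iso.symm {D E : GMData k} (f : Iso D E) : Iso E D where
  φW := f.φW.symm
  φV := f.φV.symm
  φL := f.φL.symm
  map_V₅ := map_symm_eq f.map_V₅
  map_ε x := by
    have h := f.map_ε (wedgeRestrict 5 f.φV.symm E.V₅ D.V₅ (map_symm_eq f.map_V₅) x)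
    rw [wedgeRestrict_self_symm] at h
    rw [h]
    exact (tensor_map_symm f.φL.symm f.φL.symm _).symm
  map_q v w₁ w₂ := by
    rw [← f.map_q]
    simp
  map_μ x := by
    have h := f.map_μ
      (TensorProduct.map (f.φL.symm : E.L →ₗ[k] D.L) (f.φW.symm : E.W →ₗ[k] D.W) x)
    rw [tensor_map_symm] at h
    rw [← h, wedgeRestrict_symm_self]

/-- The groupoid of GM data. -/
instance : Groupoid (GMData k) where
  Hom := Iso
  id := Iso.refl
  comp := Iso.trans
  inv := Iso.symm
  inv_comp f := by
    apply Iso.ext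
    · exact f.φW.symm_trans_self
    · exact f.φV.symm_trans_self
    · exact f.φL.symm_trans_self
  comp_inv f := by
    apply Iso.ext
    · exact f.φW.self_trans_symm
    · exact f.φV.self_trans_symm
    · exact f.φL.self_trans_symm

variable (D : GMData k)

/-- The kernel of `μ`, as a subspace `W₁` of `W` (`L` is a line). -/
def W₁ : Submodule k D.W :=
  LinearMap.ker (TensorProduct.curry D.μ).flip

/-- The data is ordinary. -/
def IsOrdinary : Prop := D.W₁ = ⊥

/-- The data is special. -/
def IsSpecial : Prop :=
  Module.finrank k D.W₁ = 1 ∧ ∀ v ∉ D.V₅, ∀ w ∈ D.W₁, w ≠ 0 → D.q v w w ≠ 0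

/-- The data is lci. -/
def IsLci : Prop := D.IsOrdinary ∨ D.IsSpecial

/-- The canonical complement `W₀` of `W₁` in `W` (for lci data): the orthogonal of `W₁` with respect
to all forms `q(v)`. For lci data, it is the only complement for which all `q(v)` decompose as sums
of a form on `W₀` and a form on `W₁`. -/
def W₀ : Submodule k D.W where
  carrier := {w | ∀ v, ∀ w₁ ∈ D.W₁, D.q v w₁ w = 0}
  add_mem' ha hb v w₁ h := by rw [map_add, ha v w₁ h, hb v w₁ h, add_zero]
  zero_mem' _ _ _ := map_zero _
  smul_mem' c x hx v w₁ h := by rw [map_smul, hx v w₁ h, smul_zero]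

/-- The bilinear map `(l ⊗ w, l' ⊗ w') ↦ b(w, w') l ⊗ l'`. -/
def pairing (b : D.W →ₗ[k] D.W →ₗ[k] k) :
    D.L ⊗[k] D.W →ₗ[k] D.L ⊗[k] D.W →ₗ[k] D.L ⊗[k] D.L :=
  (TensorProduct.map₂ (TensorProduct.mk k D.L D.L) b).compr₂
    (TensorProduct.rid k (D.L ⊗[k] D.L)).toLinearMap

lemma pairing_tmul (b : D.W →ₗ[k] D.W →ₗ[k] k) (l l' : D.L) (w w' : D.W) :
    D.pairing b (l ⊗ₜ w) (l' ⊗ₜ w') = b w w' • (l ⊗ₜ[k] l') := by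
  simp [pairing]

lemma pairing_add (b c : D.W →ₗ[k] D.W →ₗ[k] k) :
    D.pairing (b + c) = D.pairing b + D.pairing c := by
  ext; simp [pairing_tmul, add_smul]

lemma pairing_smul (t : k) (b : D.W →ₗ[k] D.W →ₗ[k] k) :
    D.pairing (t • b) = t • D.pairing b := by
  ext; simp [pairing_tmul, mul_smul]

/-- The bilinear map `(l ⊗ w, w') ↦ b(w, w') l`. -/
def contraction (b : D.W →ₗ[k] D.W →ₗ[k] k) : D.L ⊗[k] D.W →ₗ[k] D.W →ₗ[k] D.L :=
  TensorProduct.lift (LinearMap.mk₂ k (fun l w => (b w).smulRight l)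
    (fun _ _ _ => by ext; simp) (fun _ _ _ => LinearMap.ext fun _ => smul_comm _ _ _)
    (fun _ _ _ => by ext; simp [add_smul]) (fun _ _ _ => by ext; simp [mul_smul]))

lemma contraction_tmul (b : D.W →ₗ[k] D.W →ₗ[k] k) (l : D.L) (w w' : D.W) :
    D.contraction b (l ⊗ₜ w) w' = b w w' • l := by
  simp [contraction]

lemma contraction_add (b c : D.W →ₗ[k] D.W →ₗ[k] k) :
    D.contraction (b + c) = D.contraction b + D.contraction c := by
  ext; simp [contraction_tmul, add_smul]

lemma contraction_smul (t : k) (b : D.W →ₗ[k] D.W →ₗ[k] k) :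
    D.contraction (t • b) = t • D.contraction b := by
  ext; simp [contraction_tmul, mul_smul]

/-! #### The Lagrangian subspace `A` -/

/-- The map `f₂ : ⋀³V₅ ⊕ (V₆ ⊗ L ⊗ W₀) → Hom(L ⊗ W₀, L ⊗ L) = W₀^∨ ⊗ L`,
`f₂(ξ, v ⊗ l ⊗ w)(l' ⊗ w') = ε(ξ ∧ μ(l' ⊗ w')) + q(v)(w, w') l ⊗ l'`. -/
def evenF₂ : (⋀[k]^3 D.V₅ × D.V₆ ⊗[k] (D.L ⊗[k] D.W₀)) →ₗ[k]
    (D.L ⊗[k] D.W₀ →ₗ[k] D.L ⊗[k] D.L) :=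
  LinearMap.coprod
    (((wedge D.V₅ 3 2 5 rfl).compr₂ D.ε.toLinearMap).compl₂
      (D.μ ∘ₗ LinearMap.lTensor D.L D.W₀.subtype))
    (TensorProduct.lift (LinearMap.mk₂ k
      (fun v x => D.pairing (D.q v) (LinearMap.lTensor D.L D.W₀.subtype x) ∘ₗ
        LinearMap.lTensor D.L D.W₀.subtype)
      (fun _ _ _ => by simp [pairing_add, LinearMap.add_comp])
      (fun _ _ _ => by simp [pairing_smul, LinearMap.smul_comp])
      (fun _ _ _ => by simp [LinearMap.add_comp])
      (fun _ _ _ => by simp [LinearMap.smul_comp])))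

/-- The map `f₃ : ⋀³V₅ ⊕ (V₆ ⊗ L ⊗ W₀) → ⋀³V₆`,
`f₃(ξ, v ⊗ l ⊗ w) = ξ + v ∧ μ(l ⊗ w)`. -/
def evenF₃ : (⋀[k]^3 D.V₅ × D.V₆ ⊗[k] (D.L ⊗[k] D.W₀)) →ₗ[k] ⋀[k]^3 D.V₆ :=
  LinearMap.coprod
    (exteriorPower.map 3 D.V₅.subtype)
    (TensorProduct.lift ((vecWedge D.V₆ 2 3 rfl).compl₂
      (exteriorPower.map 2 D.V₅.subtype ∘ₗ D.μ ∘ₗ LinearMap.lTensor D.L D.W₀.subtype)))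

/-- The subspace `A = f₃(Ker f₂)` of `⋀³V₆`. -/
def A : Submodule k (⋀[k]^3 D.V₆) := (LinearMap.ker D.evenF₂).map D.evenF₃

/-! #### The Lagrangian subspace `A₁`

It depends on the choice of an embedding `μ₁ : W₁ → k` and of an identification
`κ : L ≃ (V₆/V₅)^∨`. -/

/-- The map `f₂ : L ⊕ (V₆ ⊗ L ⊗ W₁) → Hom(W₁, L) = W₁^∨ ⊗ L`,
`f₂(x', v ⊗ l ⊗ w)(w') = μ₁(w') x' + q(v)(w, w') l`. -/
def oddF₂ (μ₁ : D.W₁ →ₗ[k] k) :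
    (D.L × D.V₆ ⊗[k] (D.L ⊗[k] D.W₁)) →ₗ[k] (D.W₁ →ₗ[k] D.L) :=
  LinearMap.coprod
    (LinearMap.smulRightₗ μ₁)
    (TensorProduct.lift (LinearMap.mk₂ k
      (fun v x => D.contraction (D.q v) (LinearMap.lTensor D.L D.W₁.subtype x) ∘ₗ D.W₁.subtype)
      (fun _ _ _ => by simp [contraction_add, LinearMap.add_comp])
      (fun _ _ _ => by simp [contraction_smul, LinearMap.smul_comp])
      (fun _ _ _ => by simp [LinearMap.add_comp])
      (fun _ _ _ => by simp [LinearMap.smul_comp])))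

/-- The map `f₃ : L ⊕ (V₆ ⊗ L ⊗ W₁) → k ⊕ (V₆/V₅)^∨`,
`f₃(x', v ⊗ l ⊗ w) = (κ(l)(λ(v)) μ₁(w), κ(x'))`, where `λ : V₆ → V₆/V₅` is the projection. -/
def oddF₃ (μ₁ : D.W₁ →ₗ[k] k) (κ : D.L ≃ₗ[k] Module.Dual k (D.V₆ ⧸ D.V₅)) :
    (D.L × D.V₆ ⊗[k] (D.L ⊗[k] D.W₁)) →ₗ[k] (k × Module.Dual k (D.V₆ ⧸ D.V₅)) :=
  LinearMap.coprod
    (LinearMap.inr k k (Module.Dual k (D.V₆ ⧸ D.V₅)) ∘ₗ κ.toLinearMap)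
    (LinearMap.inl k k (Module.Dual k (D.V₆ ⧸ D.V₅)) ∘ₗ
      TensorProduct.lift (LinearMap.mk₂ k
        (fun v x => LinearMap.mul' k k
          (TensorProduct.map (κ.toLinearMap.flip (D.V₅.mkQ v)) μ₁ x))
        (fun _ _ _ => by simp [TensorProduct.map_add_left])
        (fun _ _ _ => by simp [TensorProduct.map_smul_left])
        (fun _ _ _ => by simp)
        (fun _ _ _ => by simp)))

/-- The subspace `A₁ = f₃(Ker f₂)` of `k ⊕ (V₆/V₅)^∨`. -/
def A₁ (μ₁ : D.W₁ →ₗ[k] k) (κ : D.L ≃ₗ[k] Module.Dual k (D.V₆ ⧸ D.V₅)) :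
    Submodule k (k × Module.Dual k (D.V₆ ⧸ D.V₅)) :=
  (LinearMap.ker (D.oddF₂ μ₁)).map (D.oddF₃ μ₁ κ)

end GMData

/-- The groupoid of lci GM data. -/
abbrev LciGMData (k : Type u) [Field k] :=
  ObjectProperty.FullSubcategory (GMData.IsLci : ObjectProperty (GMData k))

/-- The groupoid of ordinary GM data. -/
abbrev OrdinaryGMData (k : Type u) [Field k] :=
  ObjectProperty.FullSubcategory (GMData.IsOrdinary : ObjectProperty (GMData k))

/-- The inclusion of ordinary GM data into lci GM data. -/
def ordinaryToLci (k : Type u) [Field k] : OrdinaryGMData k ⥤ LciGMData k :=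
  ObjectProperty.ιOfLE fun _ h => Or.inl h

/-! ### Lagrangian data -/

/-- A Lagrangian data `(V₆, V₅, A)`. -/
structure LagrangianData (k : Type u) [Field k] where
  V₆ : Type u
  [instAddV : AddCommGroup V₆]
  [instModV : Module k V₆]
  V₅ : Submodule k V₆
  finrank_V₆ : Module.finrank k V₆ = 6
  finrank_V₅ : Module.finrank k V₅ = 5
  A : Submodule k (⋀[k]^3 V₆)
  isLagrangian_A : IsLagrangian (wedge V₆ 3 3 6 rfl) A

attribute [instance] LagrangianData.instAddV LagrangianData.instModV

section WedgeMap

variable {k : Type u} [Field k] {V V' V'' : Type u} [AddCommGroup V] [Module k V]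
  [AddCommGroup V'] [Module k V'] [AddCommGroup V''] [Module k V'']

lemma wedge_map_refl (A : Submodule k (⋀[k]^3 V)) :
    A.map (exteriorPower.map 3 (LinearEquiv.refl k V : V →ₗ[k] V)) = A := by
  simp [exteriorPower.map_id]

lemma wedge_map_trans {φ : V ≃ₗ[k] V'} {ψ : V' ≃ₗ[k] V''} {A : Submodule k (⋀[k]^3 V)}
    {A' : Submodule k (⋀[k]^3 V')} {A'' : Submodule k (⋀[k]^3 V'')}
    (h : A.map (exteriorPower.map 3 (φ : V →ₗ[k] V')) = A')
    (h' : A'.map (exteriorPower.map 3 (ψ : V' →ₗ[k] V'')) = A'') :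
    A.map (exteriorPower.map 3 ((φ.trans ψ : V ≃ₗ[k] V'') : V →ₗ[k] V'')) = A'' := by
  subst h h'
  rw [LinearEquiv.coe_trans, exteriorPower.map_comp, Submodule.map_comp]

lemma wedge_map_symm {φ : V ≃ₗ[k] V'} {A : Submodule k (⋀[k]^3 V)}
    {A' : Submodule k (⋀[k]^3 V')} (h : A.map (exteriorPower.map 3 (φ : V →ₗ[k] V')) = A') :
    A'.map (exteriorPower.map 3 (φ.symm : V' →ₗ[k] V)) = A := by
  subst h
  rw [← Submodule.map_comp, ← exteriorPower.map_comp]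
  simp [exteriorPower.map_id]

end WedgeMap

namespace LagrangianData

variable {k : Type u} [Field k]

/-- An isomorphism of Lagrangian data. -/
@[ext]
structure Iso (D E : LagrangianData k) where
  φ : D.V₆ ≃ₗ[k] E.V₆
  map_V₅ : D.V₅.map (φ : D.V₆ →ₗ[k] E.V₆) = E.V₅
  map_A : D.A.map (exteriorPower.map 3 (φ : D.V₆ →ₗ[k] E.V₆)) = E.A

/-- The groupoid of Lagrangian data. -/
instance : Groupoid (LagrangianData k) where
  Hom := Iso
  id D := ⟨LinearEquiv.refl k D.V₆, by simp, wedge_map_refl _⟩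
  comp f g := ⟨f.φ.trans g.φ, map_trans_eq f.map_V₅ g.map_V₅, wedge_map_trans f.map_A g.map_A⟩
  inv f := ⟨f.φ.symm, map_symm_eq f.map_V₅, wedge_map_symm f.map_A⟩
  inv_comp f := Iso.ext f.φ.symm_trans_self
  comp_inv f := Iso.ext f.φ.self_trans_symm

end LagrangianData

/-! ### Extended Lagrangian data -/

/-- An extended Lagrangian data `(V₆, V₅, A, A₁)`. -/
structure ExtLagrangianData (k : Type u) [Field k] extends LagrangianData k where
  A₁ : Submodule k (k × Module.Dual k (V₆ ⧸ V₅))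
  isLagrangian_A₁ : IsLagrangian (oddForm (Module.Dual k (V₆ ⧸ V₅))) A₁

section OddMap

variable {k : Type u} [Field k] {V V' V'' : Type u} [AddCommGroup V] [Module k V]
  [AddCommGroup V'] [Module k V'] [AddCommGroup V''] [Module k V'']

/-- The isomorphism `k ⊕ (V/U)^∨ → k ⊕ (V'/U')^∨` which is the identity on `k` and, on the second
summand, `t` times the isomorphism induced by an isomorphism `φ : V → V'` with `φ(U) = U'`. -/
def oddMap (φ : V ≃ₗ[k] V') (U : Submodule k V) (U' : Submodule k V')
    (h : U.map (φ : V →ₗ[k] V') = U') (t : kˣ) :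
    (k × Module.Dual k (V ⧸ U)) →ₗ[k] (k × Module.Dual k (V' ⧸ U')) :=
  LinearMap.prodMap LinearMap.id
    ((t : k) • (Submodule.Quotient.equiv U U' φ h).symm.toLinearMap.dualMap)

lemma oddMap_refl (U : Submodule k V) (h) :
    oddMap (LinearEquiv.refl k V) U U h 1 = LinearMap.id := by
  refine LinearMap.ext fun x => Prod.ext rfl ?_
  refine LinearMap.ext fun y => ?_
  induction y using Submodule.Quotient.induction_on with
  | H y =>
    simp only [oddMap, LinearMap.prodMap_apply, Units.val_one, one_smul, LinearMap.id_apply]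
    rfl

lemma oddMap_comp (φ : V ≃ₗ[k] V') (ψ : V' ≃ₗ[k] V'') (U : Submodule k V)
    (U' : Submodule k V') (U'' : Submodule k V'') (h h' h'') (s t : kˣ) :
    (oddMap ψ U' U'' h' t).comp (oddMap φ U U' h s) = oddMap (φ.trans ψ) U U'' h'' (s * t) := by
  refine LinearMap.ext fun x => Prod.ext rfl ?_
  refine LinearMap.ext fun y => ?_
  induction y using Submodule.Quotient.induction_on with
  | H y => simp [oddMap]; ring

end OddMap

namespace ExtLagrangianData

variable {k : Type u} [Field k]

/-- An isomorphism of extended Lagrangian data: an isomorphism of Lagrangian data and an element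
`t` of `kˣ` such that `t(A₁) = A₁'`. -/
@[ext]
structure Iso (D E : ExtLagrangianData k) where
  φ : D.V₆ ≃ₗ[k] E.V₆
  t : kˣ
  map_V₅ : D.V₅.map (φ : D.V₆ →ₗ[k] E.V₆) = E.V₅
  map_A : D.A.map (exteriorPower.map 3 (φ : D.V₆ →ₗ[k] E.V₆)) = E.A
  map_A₁ : D.A₁.map (oddMap φ D.V₅ E.V₅ map_V₅ t) = E.A₁

/-- The groupoid of extended Lagrangian data. -/
instance : Groupoid (ExtLagrangianData k) where
  Hom := Iso
  id D := ⟨LinearEquiv.refl k D.V₆, 1, by simp, wedge_map_refl _, by simp [oddMap_refl]⟩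
  comp {D E F} f g := ⟨f.φ.trans g.φ, f.t * g.t, map_trans_eq f.map_V₅ g.map_V₅,
    wedge_map_trans f.map_A g.map_A, by
      rw [← oddMap_comp f.φ g.φ D.V₅ E.V₅ F.V₅ f.map_V₅ g.map_V₅, Submodule.map_comp, f.map_A₁,
        g.map_A₁]⟩
  inv {D E} f := ⟨f.φ.symm, f.t⁻¹, map_symm_eq f.map_V₅, wedge_map_symm f.map_A, by
    rw [← f.map_A₁, ← Submodule.map_comp, oddMap_comp f.φ f.φ.symm D.V₅ E.V₅ D.V₅ f.map_V₅
      (map_symm_eq f.map_V₅) (by simp)]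
    simp [oddMap_refl]⟩
  id_comp f := Iso.ext rfl (one_mul _)
  comp_id f := Iso.ext rfl (mul_one _)
  assoc f g h := Iso.ext rfl (mul_assoc _ _ _)
  inv_comp f := Iso.ext f.φ.symm_trans_self (inv_mul_cancel _)
  comp_inv f := Iso.ext f.φ.self_trans_symm (mul_inv_cancel _)

/-- The condition `A₁ ≠ ∞`, that is, `A₁` is not the summand `k`. -/
def NeInfinity (D : ExtLagrangianData k) : Prop :=
  D.A₁ ≠ LinearMap.range (LinearMap.inl k k (Module.Dual k (D.V₆ ⧸ D.V₅)))

end ExtLagrangianData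

/-- The groupoid of extended Lagrangian data with `A₁ ≠ ∞`. -/
abbrev FiniteExtLagrangianData (k : Type u) [Field k] :=
  ObjectProperty.FullSubcategory
    (ExtLagrangianData.NeInfinity : ObjectProperty (ExtLagrangianData k))

/-- The forgetful functor `(V₆, V₅, A, A₁) ↦ (V₆, V₅, A)`. -/
def forgetA₁ (k : Type u) [Field k] : FiniteExtLagrangianData k ⥤ LagrangianData k where
  obj D := D.obj.toLagrangianData
  map f := ⟨f.hom.φ, f.hom.map_V₅, f.hom.map_A⟩

/-! ### From lci GM data to (extended) Lagrangian data -/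

section Functor

variable {k : Type u} [Field k]

/-- The functor `(W, V₆, V₅, L, μ, q, ε) ↦ (V₆, V₅, A)`, `(φ_W, φ_V, φ_L) ↦ φ_V`,
granted that `A` is always Lagrangian and compatible with isomorphisms of GM data. -/
def lagrangianFunctor
    (hA : ∀ D : LciGMData k, IsLagrangian (wedge D.obj.V₆ 3 3 6 rfl) D.obj.A)
    (hφ : ∀ {D E : LciGMData k} (f : D ⟶ E),
      D.obj.A.map (exteriorPower.map 3 (f.hom.φV : D.obj.V₆ →ₗ[k] E.obj.V₆)) = E.obj.A) :
    LciGMData k ⥤ LagrangianData k where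
  obj D :=
    { V₆ := D.obj.V₆
      V₅ := D.obj.V₅
      finrank_V₆ := D.obj.finrank_V₆
      finrank_V₅ := D.obj.finrank_V₅
      A := D.obj.A
      isLagrangian_A := hA D }
  map f := ⟨f.hom.φV, f.hom.map_V₅, hφ f⟩

/-- The extended Lagrangian data `(V₆, V₅, A, A₁)` for a choice of `μ₁` and `κ`, granted that
`A` and `A₁` are Lagrangian and `A₁ ≠ ∞`. -/
def extLagrangianData (D : LciGMData k)
    (hA : IsLagrangian (wedge D.obj.V₆ 3 3 6 rfl) D.obj.A)
    (μ₁ : D.obj.W₁ →ₗ[k] k) (κ : D.obj.L ≃ₗ[k] Module.Dual k (D.obj.V₆ ⧸ D.obj.V₅))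
    (hA₁ : IsLagrangian (oddForm (Module.Dual k (D.obj.V₆ ⧸ D.obj.V₅))) (D.obj.A₁ μ₁ κ))
    (hne : D.obj.A₁ μ₁ κ ≠
      LinearMap.range (LinearMap.inl k k (Module.Dual k (D.obj.V₆ ⧸ D.obj.V₅)))) :
    FiniteExtLagrangianData k where
  obj :=
    { V₆ := D.obj.V₆
      V₅ := D.obj.V₅
      finrank_V₆ := D.obj.finrank_V₆
      finrank_V₅ := D.obj.finrank_V₅
      A := D.obj.A
      isLagrangian_A := hA
      A₁ := D.obj.A₁ μ₁ κ
      isLagrangian_A₁ := hA₁ }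
  property := hne

end Functor

end GushelMukai

end

open GushelMukai

/-! Fix v outside V₅, a generator l of L and the resulting coordinate τ on ⋀⁵V₅. Then ⋀³V₆ = ⋀³V₅ ⊕
v∧⋀²V₅, both summands are isotropic, and τ makes them dual to each other. A Lagrangian in such a sum
is the same thing as a subspace of ⋀²V₅ (its projection) with a symmetric form on it. For the A of
an lci GM data, the subspace is μ(l ⊗ W₀) and the form is q(v) (`A_eq_graphLagrangian`). This shows
that A is Lagrangian. It also shows that A remembers W₀, μ and q(v) on W₀; the forms q(u) with u in
V₅ are forced by the Plücker relation (`q_eq_of_mem_V₅`).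

Injectivity in (a) follows once an isomorphism of Lagrangian data is made compatible with ε. It can
be rescaled without moving A, and the defect in ε can always be turned into a sixth power, hence a
square (`exists_scale`). For surjectivity, a linear lift of the projection of A back to A supplies
the form q(v), and isotropy of A makes it symmetric (`gmData_A`).

For (b), W₁ is zero or a line, and its only further structure is a nonzero value q(v)(w, w), which
can be normalised when square roots exist (`exists_equiv_W₁`). On the other side, A₁ ≠ ∞ is a line
spanned by some (a, d) with d ≠ 0. Only the vanishing of a matters, since t rescales a, and a = 0
exactly for ordinary data (`exists_hasSlope_A₁`). Both sides thus become a Lagrangian data together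
with one bit. -/

noncomputable section

namespace GushelMukai

/-! ### Exterior algebra: perfect pairings and the splitting ⋀³V = ⋀³U ⊕ v∧⋀²U -/

section ExteriorAlgebraLemmas

variable {k : Type u} [Field k] {V V' : Type u} [AddCommGroup V] [Module k V]
  [AddCommGroup V'] [Module k V']

@[simp]
lemma coe_wedge {p q r : ℕ} (h : p + q = r) (x : ⋀[k]^p V) (y : ⋀[k]^q V) :
    (wedge V p q r h x y : ExteriorAlgebra k V) = x * y := rfl

@[simp]
lemma coe_vecWedge {p r : ℕ} (h : 1 + p = r) (v : V) (x : ⋀[k]^p V) :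
    (vecWedge V p r h v x : ExteriorAlgebra k V) = ExteriorAlgebra.ι k v * x := by
  have : ((exteriorPower.oneEquiv k V).symm v : ExteriorAlgebra k V) = ExteriorAlgebra.ι k v := by
    have : (exteriorPower.oneEquiv k V).symm v = exteriorPower.ιMulti k 1 (fun _ => v) := by
      rw [LinearEquiv.symm_apply_eq, exteriorPower.oneEquiv_ιMulti]
    rw [this]
    simp
  simp [vecWedge, this]

@[simp]
lemma coe_exteriorPower_map (p : ℕ) (f : V →ₗ[k] V') (x : ⋀[k]^p V) :
    (exteriorPower.map p f x : ExteriorAlgebra k V') = ExteriorAlgebra.map f x := by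
  have : (⋀[k]^p V').subtype ∘ₗ exteriorPower.map p f =
      (ExteriorAlgebra.map f).toLinearMap ∘ₗ (⋀[k]^p V).subtype := by
    ext v
    simp [ExteriorAlgebra.map_apply_ιMulti, Function.comp_def]
  exact LinearMap.congr_fun this x

lemma map_wedge {p q r : ℕ} (h : p + q = r) (f : V →ₗ[k] V') (x : ⋀[k]^p V) (y : ⋀[k]^q V) :
    exteriorPower.map r f (wedge V p q r h x y) =
      wedge V' p q r h (exteriorPower.map p f x) (exteriorPower.map q f y) :=
  Subtype.ext (by simp)

lemma map_vecWedge {p r : ℕ} (h : 1 + p = r) (f : V →ₗ[k] V') (v : V) (x : ⋀[k]^p V) :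
    exteriorPower.map r f (vecWedge V p r h v x) =
      vecWedge V' p r h (f v) (exteriorPower.map p f x) :=
  Subtype.ext (by simp)

lemma mul_ι_of_mem_exteriorPower (v : V) (p : ℕ) {x : ExteriorAlgebra k V} (hx : x ∈ ⋀[k]^p V) :
    x * ExteriorAlgebra.ι k v = (-1) ^ p * (ExteriorAlgebra.ι k v * x) := by
  refine Submodule.pow_induction_on_left' (LinearMap.range (ExteriorAlgebra.ι k))
    (C := fun p x _ => x * ExteriorAlgebra.ι k v = (-1) ^ p * (ExteriorAlgebra.ι k v * x))
    (fun r => ?_) (fun x y i _ _ hx hy => ?_) ?_ hx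
  · rw [pow_zero, one_mul]
    exact Algebra.commutes r _
  · rw [add_mul, hx, hy, mul_add, mul_add]
  · rintro _ ⟨u, rfl⟩ i x _ hx
    have huv := eq_neg_of_add_eq_zero_left (ExteriorAlgebra.ι_add_mul_swap (R := k) u v)
    rw [mul_assoc, hx, ← mul_assoc, ((Commute.neg_one_right _).pow_right i).eq, mul_assoc,
      ← mul_assoc _ _ x, huv, pow_succ, mul_assoc]
    simp [mul_assoc]

lemma commute_of_mem_exteriorPower_two {x : ExteriorAlgebra k V} (hx : x ∈ ⋀[k]^2 V)
    (y : ExteriorAlgebra k V) : x * y = y * x := by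
  induction y using ExteriorAlgebra.induction with
  | algebraMap r => exact (Algebra.commutes r x).symm
  | ι v => simpa using mul_ι_of_mem_exteriorPower v 2 hx
  | mul a b ha hb => rw [← mul_assoc, ha, mul_assoc, hb, mul_assoc]
  | add a b ha hb => rw [mul_add, ha, hb, add_mul]

lemma wedge_two_comm {p r : ℕ} (h : p + 2 = r) (h' : 2 + p = r) (x : ⋀[k]^p V) (y : ⋀[k]^2 V) :
    wedge V p 2 r h x y = wedge V 2 p r h' y x :=
  Subtype.ext (commute_of_mem_exteriorPower_two y.2 x).symm

/-- The pairing `⋀^p V × ⋀^q V → ⋀^n V`, where `n = dim V = p + q`, is perfect. -/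
lemma exists_wedge_eq [FiniteDimensional k V] {p q n : ℕ} (h : p + q = n)
    (hn : Module.finrank k V = n) (f : ⋀[k]^q V →ₗ[k] ⋀[k]^n V) :
    ∃ x : ⋀[k]^p V, ∀ y, wedge V p q n h x y = f y := by
  classical
  subst h
  let b := Module.finBasisOfFinrankEq k V hn
  -- Up to a scalar, the dual of a basis monomial is the monomial on the complementary indices: its
  -- wedge with any other monomial of degree q repeats an index.
  have key : ∀ s : Set.powersetCard (Fin (p + q)) q, ∃ x : ⋀[k]^p V,
      wedge V p q (p + q) rfl x (exteriorPower.ιMulti_family k q b s) =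
          f (exteriorPower.ιMulti_family k q b s) ∧
      ∀ t ≠ s, wedge V p q (p + q) rfl x (exteriorPower.ιMulti_family k q b t) = 0 := by
    intro s
    have hcard : p + q = Fintype.card (Fin (p + q)) := by simp
    let s' : Set.powersetCard (Fin (p + q)) p := Set.powersetCard.compl hcard s
    have hs' : Disjoint s'.val s.val := by
      rw [Set.powersetCard.coe_compl]
      exact disjoint_compl_left
    have hx : wedge V p q (p + q) rfl (exteriorPower.ιMulti_family k p b s')
        (exteriorPower.ιMulti_family k q b s) ≠ 0 := by
      have h0 : (Set.powersetCard.permOfDisjoint hs').sign •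
          exteriorPower.ιMulti_family k (p + q) b (Set.powersetCard.disjUnion hs') ≠ 0 := by
        rw [Ne, smul_eq_zero_iff_eq, ← exteriorPower.basis_apply]
        exact (b.exteriorPower (p + q)).ne_zero _
      refine fun h => h0 (Subtype.ext ?_)
      rw [← h]
      exact (ExteriorAlgebra.ιMulti_family_mul_of_disjoint k b s' s hs').symm
    have h1 : Module.finrank k (⋀[k]^(p + q) V) = 1 := by
      rw [exteriorPower.finrank_eq, hn, Nat.choose_self]
    obtain ⟨c, hc⟩ := exists_smul_eq_of_finrank_eq_one h1 hx
      (f (exteriorPower.ιMulti_family k q b s))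
    refine ⟨c • exteriorPower.ιMulti_family k p b s', by simpa using hc, fun t hts => ?_⟩
    rw [map_smul, LinearMap.smul_apply]
    refine smul_eq_zero_of_right _ (Subtype.ext ?_)
    refine ExteriorAlgebra.ιMulti_family_mul_of_not_disjoint k b s' t fun hd => hts ?_
    rw [Set.powersetCard.eq_iff_subset, ← disjoint_compl_left_iff]
    rwa [Set.powersetCard.coe_compl] at hd
  choose x hx hx' using key
  refine ⟨∑ s, x s, fun y => ?_⟩
  suffices wedge V p q (p + q) rfl (∑ s, x s) = f from LinearMap.congr_fun this y
  refine (b.exteriorPower q).ext fun t => ?_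
  rw [exteriorPower.basis_apply, map_sum, LinearMap.sum_apply, Finset.sum_eq_single t, hx]
  · exact fun s _ hs => hx' s t hs.symm
  · simp

/-- A functional d that vanishes on U but not at v gives a contraction that kills ⋀U, so it sends
v∧x to d(v)x and x is recovered. -/
lemma vecWedge_map_injective {p r : ℕ} (h : 1 + p = r) {U : Submodule k V} {v : V} (hv : v ∉ U) :
    Function.Injective
      (vecWedge V p r h v ∘ₗ exteriorPower.map p U.subtype : ⋀[k]^p U →ₗ[k] ⋀[k]^r V) := by
  obtain ⟨d, hd, hU⟩ := Submodule.exists_le_ker_of_notMem hv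
  rw [injective_iff_map_eq_zero]
  intro x hx
  have hmap (y : ExteriorAlgebra k U) :
      CliffordAlgebra.contractLeft (Q := (0 : QuadraticForm k V)) d
        (ExteriorAlgebra.map U.subtype y) = 0 := by
    induction y using CliffordAlgebra.left_induction with
    | algebraMap r => simp [CliffordAlgebra.contractLeft_algebraMap]
    | add a b ha hb => simp [ha, hb]
    | ι_mul a u ha =>
      have : ExteriorAlgebra.map U.subtype (CliffordAlgebra.ι _ u * a) =
        CliffordAlgebra.ι (0 : QuadraticForm k V) u * ExteriorAlgebra.map U.subtype a := by
        rw [map_mul]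
        exact congrArg (· * _) (ExteriorAlgebra.map_apply_ι _ u)
      rw [this, CliffordAlgebra.contractLeft_ι_mul, ha, mul_zero, sub_zero,
        show d u = 0 from hU u.2, zero_smul]
  have hx' := congrArg (fun z : ⋀[k]^r V =>
    CliffordAlgebra.contractLeft (Q := (0 : QuadraticForm k V)) d (z : ExteriorAlgebra k V)) hx
  have h0 : CliffordAlgebra.contractLeft (Q := (0 : QuadraticForm k V)) d
      (CliffordAlgebra.ι _ v * ExteriorAlgebra.map U.subtype (x : ExteriorAlgebra k U)) = 0 := by
    simpa using hx'
  rw [CliffordAlgebra.contractLeft_ι_mul, hmap, mul_zero, sub_zero, smul_eq_zero,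
    or_iff_right hd] at h0
  refine exteriorPower.map_injective_field (n := p) U.subtype_injective (Subtype.ext ?_)
  rw [map_zero, coe_exteriorPower_map]
  exact h0

/-- The map `(ξ, η) ↦ ξ + v ∧ η` from `⋀^3 U ⊕ ⋀^2 U` to `⋀^3 V`. -/
def wedgeSplit (U : Submodule k V) (v : V) : (⋀[k]^3 U × ⋀[k]^2 U) →ₗ[k] ⋀[k]^3 V :=
  LinearMap.coprod (exteriorPower.map 3 U.subtype)
    (vecWedge V 2 3 rfl v ∘ₗ exteriorPower.map 2 U.subtype)

lemma wedgeSplit_apply (U : Submodule k V) (v : V) (ξ : ⋀[k]^3 U) (η : ⋀[k]^2 U) :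
    wedgeSplit U v (ξ, η) =
      exteriorPower.map 3 U.subtype ξ + vecWedge V 2 3 rfl v (exteriorPower.map 2 U.subtype η) :=
  rfl

lemma coe_wedgeSplit (U : Submodule k V) (v : V) (ξ : ⋀[k]^3 U) (η : ⋀[k]^2 U) :
    (wedgeSplit U v (ξ, η) : ExteriorAlgebra k V) = ExteriorAlgebra.map U.subtype ξ +
      ExteriorAlgebra.ι k v * ExteriorAlgebra.map U.subtype η := by
  simp [wedgeSplit_apply]

/-- A retraction of V onto U that kills v recovers ξ; wedging with v is injective on ⋀²U, which
gives η. -/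
lemma wedgeSplit_injective {U : Submodule k V} {v : V} (hv : v ∉ U) :
    Function.Injective (wedgeSplit U v) := by
  obtain ⟨f, hf, hfv⟩ := LinearMap.exists_extend_of_notMem LinearMap.id hv 0
  rw [injective_iff_map_eq_zero]
  rintro ⟨ξ, η⟩ h
  have hξ : ξ = 0 := by
    have h' := congrArg (exteriorPower.map 3 f) h
    rwa [wedgeSplit_apply, map_add, map_vecWedge, hfv, map_zero, LinearMap.zero_apply, add_zero,
      ← LinearMap.comp_apply, ← exteriorPower.map_comp, hf, exteriorPower.map_id, map_zero] at h'
  subst hξ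
  rw [wedgeSplit_apply, map_zero, zero_add] at h
  rw [(injective_iff_map_eq_zero _).1 (vecWedge_map_injective rfl hv) η h]
  rfl

lemma wedgeSplit_surjective {U : Submodule k V} (hV : Module.finrank k V = 6)
    (hU : Module.finrank k U = 5) {v : V} (hv : v ∉ U) :
    Function.Surjective (wedgeSplit U v) := by
  have : FiniteDimensional k V := Module.finite_of_finrank_pos (by omega)
  refine (LinearMap.injective_iff_surjective_of_finrank_eq_finrank ?_).1 (wedgeSplit_injective hv)
  -- The dimension count is 10 + 10 = 20.
  rw [Module.finrank_prod, exteriorPower.finrank_eq, exteriorPower.finrank_eq,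
    exteriorPower.finrank_eq, hV, hU]
  rfl

/-- Both summands are isotropic, because ⋀⁶U = 0 and v∧v = 0. Only the cross terms remain, and the
minus sign comes from moving v past the trivector ξ. -/
lemma wedge_wedgeSplit {U : Submodule k V} (hU : Module.finrank k U = 5) (v : V)
    (ξ ξ' : ⋀[k]^3 U) (η η' : ⋀[k]^2 U) :
    wedge V 3 3 6 rfl (wedgeSplit U v (ξ, η)) (wedgeSplit U v (ξ', η')) =
      vecWedge V 5 6 rfl v (exteriorPower.map 5 U.subtype
        (wedge U 3 2 5 rfl ξ' η - wedge U 3 2 5 rfl ξ η')) := by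
  have : FiniteDimensional k U := Module.finite_of_finrank_pos (by omega)
  have : Subsingleton (⋀[k]^6 U) := by
    rw [← Module.finrank_zero_iff (R := k), exteriorPower.finrank_eq, hU]
    rfl
  have h1 : ExteriorAlgebra.map U.subtype (ξ : ExteriorAlgebra k U) *
      ExteriorAlgebra.map U.subtype (ξ' : ExteriorAlgebra k U) = 0 := by
    rw [← map_mul, ← coe_wedge (rfl : 3 + 3 = 6), Subsingleton.elim (wedge U 3 3 6 rfl ξ ξ') 0,
      ZeroMemClass.coe_zero, map_zero]
  have h2 := mul_ι_of_mem_exteriorPower v 3 (exteriorPower.map 3 U.subtype ξ).2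
  have h3 := commute_of_mem_exteriorPower_two (exteriorPower.map 2 U.subtype η).2
  rw [coe_exteriorPower_map] at h2 h3
  have h4 (Y : ExteriorAlgebra k V) : ExteriorAlgebra.map U.subtype (ξ : ExteriorAlgebra k U) *
      (ExteriorAlgebra.ι k v * Y) =
      -(ExteriorAlgebra.ι k v * (ExteriorAlgebra.map U.subtype (ξ : ExteriorAlgebra k U) * Y)) := by
    rw [← mul_assoc, h2]
    simp [pow_succ, mul_assoc]
  have h5 (Y : ExteriorAlgebra k V) : ExteriorAlgebra.ι k v *
      (ExteriorAlgebra.map U.subtype (η : ExteriorAlgebra k U) * (ExteriorAlgebra.ι k v * Y)) =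
      0 := by
    rw [h3, mul_assoc, ← mul_assoc, ExteriorAlgebra.ι_sq_zero, zero_mul]
  refine Subtype.ext ?_
  simp only [coe_wedge, coe_wedgeSplit, coe_vecWedge, coe_exteriorPower_map, Submodule.coe_sub,
    map_sub, map_mul, add_mul, mul_add, mul_assoc, h1, h4, h5]
  rw [h3, zero_add, add_zero, sub_eq_add_neg]

/-- A vector `u ∈ U` may be moved from the coefficient `v` to the first component. -/
lemma vecWedge_add_eq_wedgeSplit (U : Submodule k V) (v : V) (a : k) (u : U) (η : ⋀[k]^2 U) :
    vecWedge V 2 3 rfl (a • v + u) (exteriorPower.map 2 U.subtype η) =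
      wedgeSplit U v (vecWedge U 2 3 rfl u η, a • η) := by
  rw [wedgeSplit_apply, map_vecWedge, map_add, map_smul, map_smul, map_smul, add_comm]
  rfl

end ExteriorAlgebraLemmas

/-! ### Lagrangians as symmetric forms on subspaces of ⋀²U -/

section GraphLagrangian

variable {k : Type u} [Field k] {V V' W : Type u} [AddCommGroup V] [Module k V]
  [AddCommGroup V'] [Module k V'] [AddCommGroup W] [Module k W]

/-- The subspace of `⋀^3 V` of all `ξ + v ∧ m(w)` such that `τ(ξ ∧ m(w')) = -B(w, w')` for all
`w'`. -/
def graphLagrangian {U : Submodule k V} (v : V) (τ : ⋀[k]^5 U ≃ₗ[k] k) (m : W →ₗ[k] ⋀[k]^2 U)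
    (B : W →ₗ[k] W →ₗ[k] k) : Submodule k (⋀[k]^3 V) where
  carrier := {x | ∃ ξ w, (∀ w', τ (wedge U 3 2 5 rfl ξ (m w')) + B w w' = 0) ∧
    wedgeSplit U v (ξ, m w) = x}
  zero_mem' := ⟨0, 0, by simp, by rw [map_zero]; exact map_zero _⟩
  add_mem' := by
    rintro _ _ ⟨ξ, w, h, rfl⟩ ⟨ξ', w', h', rfl⟩
    refine ⟨ξ + ξ', w + w', fun w'' => ?_, ?_⟩
    · simp only [map_add, LinearMap.add_apply]
      linear_combination h w'' + h' w''
    · rw [← map_add, map_add m, Prod.mk_add_mk]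
  smul_mem' := by
    rintro c _ ⟨ξ, w, h, rfl⟩
    refine ⟨c • ξ, c • w, fun w'' => ?_, ?_⟩
    · simp only [map_smul, LinearMap.smul_apply, smul_eq_mul]
      linear_combination c * h w''
    · rw [← map_smul, map_smul m, Prod.smul_mk]

lemma exists_wedge_eq_dual {U : Submodule k V} (hU : Module.finrank k U = 5)
    (τ : ⋀[k]^5 U ≃ₗ[k] k) (g : ⋀[k]^2 U →ₗ[k] k) :
    ∃ ξ, ∀ η, τ (wedge U 3 2 5 rfl ξ η) = g η := by
  have : FiniteDimensional k U := Module.finite_of_finrank_pos (by omega)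
  obtain ⟨ξ, hξ⟩ := exists_wedge_eq (rfl : 3 + 2 = 5) hU (τ.symm.toLinearMap ∘ₗ g)
  exact ⟨ξ, fun η => by simp [hξ]⟩

lemma wedge_wedgeSplit_eq_zero_iff {U : Submodule k V} (hU : Module.finrank k U = 5) {v : V}
    (hv : v ∉ U) (τ : ⋀[k]^5 U ≃ₗ[k] k) (ξ ξ' : ⋀[k]^3 U) (η η' : ⋀[k]^2 U) :
    wedge V 3 3 6 rfl (wedgeSplit U v (ξ, η)) (wedgeSplit U v (ξ', η')) = 0 ↔
      τ (wedge U 3 2 5 rfl ξ' η) = τ (wedge U 3 2 5 rfl ξ η') := by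
  rw [wedge_wedgeSplit hU, ← LinearMap.comp_apply,
    map_eq_zero_iff _ (vecWedge_map_injective rfl hv), sub_eq_zero, τ.injective.eq_iff]

/-- Isotropy is the symmetry of B. Maximality comes from testing an orthogonal vector first against
elements over 0, which puts its second component in the range of m, and then against a lift of each
w', which gives the defining equation. -/
lemma isLagrangian_graphLagrangian {U : Submodule k V} (hV : Module.finrank k V = 6)
    (hU : Module.finrank k U = 5) {v : V} (hv : v ∉ U) (τ : ⋀[k]^5 U ≃ₗ[k] k)
    {m : W →ₗ[k] ⋀[k]^2 U} (hm : Function.Injective m) {B : W →ₗ[k] W →ₗ[k] k}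
    (hB : ∀ w w', B w w' = B w' w) :
    IsLagrangian (wedge V 3 3 6 rfl) (graphLagrangian v τ m B) := by
  intro x
  constructor
  · rintro ⟨ξ, w, h, rfl⟩ _ ⟨ξ', w', h', rfl⟩
    rw [wedge_wedgeSplit_eq_zero_iff hU hv τ]
    linear_combination h' w - h w' + hB w w'
  · intro hx
    obtain ⟨⟨ξ, η⟩, rfl⟩ := wedgeSplit_surjective hV hU hv x
    obtain ⟨n, hn⟩ := m.exists_leftInverse_of_injective (LinearMap.ker_eq_bot.2 hm)
    have hη : η ∈ LinearMap.range m := by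
      -- Otherwise some functional vanishes on the range of m but not at η; the trivector
      -- representing it lies in the graph over 0 and is not orthogonal to x.
      by_contra hη
      obtain ⟨g, hg, hgm⟩ := Submodule.exists_le_ker_of_notMem hη
      obtain ⟨ξ', hξ'⟩ := exists_wedge_eq_dual hU τ g
      refine hg ?_
      rw [← hξ']
      have h := hx (wedgeSplit U v (ξ', m 0)) ⟨ξ', 0, fun w' => by
        rw [hξ', show g (m w') = 0 from hgm ⟨w', rfl⟩]; simp, rfl⟩
      rw [wedge_wedgeSplit_eq_zero_iff hU hv τ] at h
      simpa using h
    obtain ⟨w, rfl⟩ := hη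
    refine ⟨ξ, w, fun w' => ?_, rfl⟩
    -- The left inverse n of m extends the functional -B(w', ·) from the range of m to all of ⋀²U,
    -- so that perfectness of the pairing yields a lift of w'.
    obtain ⟨ξ', hξ'⟩ := exists_wedge_eq_dual hU τ (-(B w' ∘ₗ n))
    have hn' (w : W) : n (m w) = w := LinearMap.congr_fun hn w
    have h := hx (wedgeSplit U v (ξ', m w'))
      ⟨ξ', w', fun w'' => by rw [hξ']; simp [hn'], rfl⟩
    rw [wedge_wedgeSplit_eq_zero_iff hU hv τ, hξ'] at h
    rw [← h]
    simp [hn', hB w w']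

/-- A Lagrangian is maximal among isotropic subspaces, so equality of Lagrangians needs only one
inclusion. -/
lemma IsLagrangian.eq_of_le {M N : Type u} [AddCommGroup M] [Module k M] [AddCommGroup N]
    [Module k N] {ω : M →ₗ[k] M →ₗ[k] N} {A B : Submodule k M} (hA : IsLagrangian ω A)
    (hB : IsLagrangian ω B) (h : A ≤ B) : A = B :=
  h.antisymm fun x hx => (hA x).2 fun y hy => (hB x).1 hx y (h hy)

/-- The image of `A ⊆ ⋀^3 V` in `⋀^3 V / ⋀^3 U`, identified with `⋀^2 U` by means of `v`. -/
def wedgeProj (U : Submodule k V) (v : V) (A : Submodule k (⋀[k]^3 V)) :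
    Submodule k (⋀[k]^2 U) :=
  (A.comap (wedgeSplit U v)).map (LinearMap.snd k _ _)

lemma mem_wedgeProj {U : Submodule k V} {v : V} {A : Submodule k (⋀[k]^3 V)} {η : ⋀[k]^2 U} :
    η ∈ wedgeProj U v A ↔ ∃ ξ, wedgeSplit U v (ξ, η) ∈ A := by
  simp [wedgeProj]

lemma wedgeProj_graphLagrangian {U : Submodule k V} (hU : Module.finrank k U = 5) {v : V}
    (hv : v ∉ U) (τ : ⋀[k]^5 U ≃ₗ[k] k) {m : W →ₗ[k] ⋀[k]^2 U} (hm : Function.Injective m)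
    (B : W →ₗ[k] W →ₗ[k] k) :
    wedgeProj U v (graphLagrangian v τ m B) = LinearMap.range m := by
  ext η
  rw [mem_wedgeProj]
  constructor
  · rintro ⟨ξ, ξ', w, -, h⟩
    exact ⟨w, congrArg Prod.snd (wedgeSplit_injective hv h)⟩
  · rintro ⟨w, rfl⟩
    obtain ⟨n, hn⟩ := m.exists_leftInverse_of_injective (LinearMap.ker_eq_bot.2 hm)
    have hn' (w : W) : n (m w) = w := LinearMap.congr_fun hn w
    obtain ⟨ξ, hξ⟩ := exists_wedge_eq_dual hU τ (-(B w ∘ₗ n))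
    exact ⟨ξ, ξ, w, fun w' => by rw [hξ]; simp [hn'], rfl⟩

/-- Since m is injective, a point of the graph determines its parameter w. The form B can therefore
be read off from the subspace, using any point over m(w). -/
lemma eq_of_wedgeSplit_mem_graphLagrangian {U : Submodule k V} {v : V}
    (hv : v ∉ U) {τ : ⋀[k]^5 U ≃ₗ[k] k} {m : W →ₗ[k] ⋀[k]^2 U} (hm : Function.Injective m)
    {B : W →ₗ[k] W →ₗ[k] k} {ξ : ⋀[k]^3 U} {w : W}
    (h : wedgeSplit U v (ξ, m w) ∈ graphLagrangian v τ m B) (w' : W) :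
    τ (wedge U 3 2 5 rfl ξ (m w')) + B w w' = 0 := by
  obtain ⟨ξ', w'', h', h''⟩ := h
  have := wedgeSplit_injective hv h''
  rw [Prod.mk_inj, hm.eq_iff] at this
  obtain ⟨rfl, rfl⟩ := this
  exact h' w'

/-! ### Transport along an isomorphism of pairs (V, U) -/

section Transport

variable (φ : V ≃ₗ[k] V') {U : Submodule k V} {U' : Submodule k V'}
  (h : U.map (φ : V →ₗ[k] V') = U')

lemma apply_notMem_of_map_eq {φ : V ≃ₗ[k] V'} {U : Submodule k V} {U' : Submodule k V'}
    (h : U.map (φ : V →ₗ[k] V') = U') {v : V} (hv : v ∉ U) : φ v ∉ U' := by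
  subst h
  simpa using hv

lemma map_map_subtype (p : ℕ) (x : ⋀[k]^p U) :
    exteriorPower.map p (φ : V →ₗ[k] V') (exteriorPower.map p U.subtype x) =
      exteriorPower.map p U'.subtype (wedgeRestrict p φ U U' h x) := by
  rw [wedgeRestrict, ← LinearMap.comp_apply, ← LinearMap.comp_apply, ← exteriorPower.map_comp,
    ← exteriorPower.map_comp]
  rfl

lemma map_wedgeSplit (v : V) (ξ : ⋀[k]^3 U) (η : ⋀[k]^2 U) :
    exteriorPower.map 3 (φ : V →ₗ[k] V') (wedgeSplit U v (ξ, η)) =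
      wedgeSplit U' (φ v) (wedgeRestrict 3 φ U U' h ξ, wedgeRestrict 2 φ U U' h η) := by
  rw [wedgeSplit_apply, wedgeSplit_apply, map_add, map_vecWedge, map_map_subtype φ h,
    map_map_subtype φ h]
  rfl

lemma wedgeRestrict_wedge {p q r : ℕ} (hr : p + q = r) (x : ⋀[k]^p U) (y : ⋀[k]^q U) :
    wedgeRestrict r φ U U' h (wedge U p q r hr x y) =
      wedge U' p q r hr (wedgeRestrict p φ U U' h x) (wedgeRestrict q φ U U' h y) :=
  map_wedge hr _ x y

/-- The isomorphism `⋀^p U → ⋀^p U'` induced by an isomorphism `φ` with `φ(U) = U'`. -/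
def wedgeRestrictEquiv (p : ℕ) : ⋀[k]^p U ≃ₗ[k] ⋀[k]^p U' :=
  LinearEquiv.ofLinearMap (wedgeRestrict p φ U U' h) (wedgeRestrict p φ.symm U' U (map_symm_eq h))
    (LinearMap.ext fun x => wedgeRestrict_self_symm p φ U U' h _ x)
    (LinearMap.ext fun x => wedgeRestrict_symm_self p φ U U' h _ x)

@[simp]
lemma wedgeRestrictEquiv_apply (p : ℕ) (x : ⋀[k]^p U) :
    wedgeRestrictEquiv φ h p x = wedgeRestrict p φ U U' h x := rfl

lemma map_wedgeProj (v : V) (A : Submodule k (⋀[k]^3 V)) :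
    (wedgeProj U v A).map (wedgeRestrictEquiv φ h 2 : ⋀[k]^2 U →ₗ[k] ⋀[k]^2 U') =
      wedgeProj U' (φ v) (A.map (exteriorPower.map 3 (φ : V →ₗ[k] V'))) := by
  have hφ : Function.Injective (exteriorPower.map 3 (φ : V →ₗ[k] V')) :=
    exteriorPower.map_injective_field φ.injective
  ext η'
  obtain ⟨η, rfl⟩ := (wedgeRestrictEquiv φ h 2).surjective η'
  rw [Submodule.mem_map_equiv, LinearEquiv.symm_apply_apply, mem_wedgeProj, mem_wedgeProj,
    (wedgeRestrictEquiv φ h 3).surjective.exists]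
  simp only [wedgeRestrictEquiv_apply, ← map_wedgeSplit, Submodule.mem_map, hφ.eq_iff,
    exists_eq_right]

end Transport

end GraphLagrangian

/-! ### One-dimensional spaces and hyperplanes -/

section Lines

variable {k : Type u} [Field k] {N N' : Type u} [AddCommGroup N] [Module k N]
  [AddCommGroup N'] [Module k N']

lemma exists_lineEquiv (h : Module.finrank k N = 1) {x : N} (hx : x ≠ 0) :
    ∃ e : N ≃ₗ[k] k, ∀ y, y = e y • x := by
  let e := LinearEquiv.ofBijective (LinearMap.toSpanSingleton k N x)
    ⟨smul_left_injective k hx, fun y => exists_smul_eq_of_finrank_eq_one h hx y⟩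
  exact ⟨e.symm, fun y => (e.apply_symm_apply y).symm⟩

lemma exists_equiv_of_finrank_eq_one (h : Module.finrank k N = 1)
    (h' : Module.finrank k N' = 1) {x : N} (hx : x ≠ 0) {x' : N'} (hx' : x' ≠ 0) :
    ∃ e : N ≃ₗ[k] N', e x = x' := by
  obtain ⟨e, he⟩ := exists_lineEquiv h hx
  obtain ⟨e', he'⟩ := exists_lineEquiv h' hx'
  refine ⟨e.trans e'.symm, ?_⟩
  rw [LinearEquiv.trans_apply, LinearEquiv.symm_apply_eq]
  have h1 : e x = 1 := smul_left_injective k hx ((he x).symm.trans (one_smul k x).symm)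
  have h2 : e' x' = 1 := smul_left_injective k hx' ((he' x').symm.trans (one_smul k x').symm)
  rw [h1, h2]

lemma exists_ne_zero_of_finrank_eq_one (h : Module.finrank k N = 1) : ∃ x : N, x ≠ 0 := by
  have := Module.nontrivial_of_finrank_pos (R := k) (M := N) (by omega)
  exact exists_ne 0

lemma tmul_ne_zero_of_ne_zero {x : N} {y : N'} (hx : x ≠ 0) (hy : y ≠ 0) :
    x ⊗ₜ[k] y ≠ 0 := by
  intro h
  obtain ⟨f, hf, -⟩ := Submodule.exists_le_ker_of_notMem (p := (⊥ : Submodule k N)) (v := x) hx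
  obtain ⟨g, hg, -⟩ := Submodule.exists_le_ker_of_notMem (p := (⊥ : Submodule k N')) (v := y) hy
  have := congrArg (fun z => LinearMap.mul' k k (TensorProduct.map f g z)) h
  simp [hf, hg] at this

lemma exists_eq_tmul_of_finrank_eq_one (h : Module.finrank k N = 1) {x : N} (hx : x ≠ 0)
    (z : N ⊗[k] N') : ∃ y, z = x ⊗ₜ y := by
  obtain ⟨e, he⟩ := exists_lineEquiv h hx
  induction z using TensorProduct.induction_on with
  | zero => exact ⟨0, (tmul_zero _ _).symm⟩
  | tmul a b => exact ⟨e a • b, by rw [← smul_tmul, ← he]⟩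
  | add a b ha hb =>
    obtain ⟨a', rfl⟩ := ha
    obtain ⟨b', rfl⟩ := hb
    exact ⟨a' + b', (tmul_add _ _ _).symm⟩

lemma exists_notMem_of_finrank_lt {U : Submodule k N}
    (h : Module.finrank k U < Module.finrank k N) : ∃ v, v ∉ U := by
  by_contra! hU
  rw [Submodule.eq_top_iff'.2 hU, finrank_top] at h
  exact lt_irrefl _ h

/-- A vector outside a hyperplane spans a complement. -/
lemma exists_eq_smul_add {U : Submodule k N}
    (h : Module.finrank k N = Module.finrank k U + 1) {v : N} (hv : v ∉ U) (x : N) :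
    ∃ (a : k) (u : U), x = a • v + u := by
  have : FiniteDimensional k N := Module.finite_of_finrank_pos (by omega)
  have h1 : Module.finrank k (N ⧸ U) = 1 := by
    have := Submodule.finrank_quotient_add_finrank U
    omega
  have h2 : U.mkQ v ≠ 0 := by simpa using hv
  obtain ⟨e, he⟩ := exists_lineEquiv h1 h2
  refine ⟨e (U.mkQ x), ⟨x - e (U.mkQ x) • v, ?_⟩, by simp⟩
  rw [← Submodule.Quotient.mk_eq_zero, ← U.mkQ_apply, map_sub, map_smul, ← he, sub_self]

end Lines

/-! ### The Lagrangian A of an lci GM data, and its functoriality -/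

lemma vecWedge_wedge {k : Type u} [Field k] {V : Type u} [AddCommGroup V] [Module k V] (v : V)
    (x y : ⋀[k]^2 V) :
    vecWedge V 4 5 rfl v (wedge V 2 2 4 rfl x y) =
      wedge V 3 2 5 rfl (vecWedge V 2 3 rfl v x) y :=
  Subtype.ext (by simp [mul_assoc])

namespace GMData

variable {k : Type u} [Field k] (D : GMData k)

/-- The linear map `w ↦ μ(l ⊗ w)`. -/
def μAt (l : D.L) : D.W →ₗ[k] ⋀[k]^2 D.V₅ := D.μ ∘ₗ TensorProduct.mk k D.L D.W l

lemma μAt_apply (l : D.L) (w : D.W) : D.μAt l w = D.μ (l ⊗ₜ w) := rfl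

/-- The restriction of the form `q(v)` to `W₀`. -/
def q₀ (v : D.V₆) : D.W₀ →ₗ[k] D.W₀ →ₗ[k] k := (D.q v).domRestrict₁₂ D.W₀ D.W₀

lemma q₀_apply (v : D.V₆) (w w' : D.W₀) : D.q₀ v w w' = D.q v w w' := rfl

lemma exists_notMem_V₅ : ∃ v, v ∉ D.V₅ :=
  exists_notMem_of_finrank_lt (k := k) (by rw [D.finrank_V₅, D.finrank_V₆]; norm_num)

lemma exists_eq_smul_add_V₅ {v : D.V₆} (hv : v ∉ D.V₅) (x : D.V₆) :
    ∃ (a : k) (u : D.V₅), x = a • v + u :=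
  exists_eq_smul_add (by rw [D.finrank_V₅, D.finrank_V₆]) hv x

variable {D}

lemma exists_coordinate {l : D.L} (hl : l ≠ 0) :
    ∃ τ : ⋀[k]^5 D.V₅ ≃ₗ[k] k, ∀ z, D.ε z = τ z • (l ⊗ₜ[k] l) := by
  have h : Module.finrank k (D.L ⊗[k] D.L) = 1 := by
    rw [Module.finrank_tensorProduct, D.finrank_L]
  obtain ⟨e, he⟩ := exists_lineEquiv h (tmul_ne_zero_of_ne_zero (k := k) hl hl)
  exact ⟨D.ε.trans e, fun z => he _⟩

lemma smul_tmul_injective {l : D.L} (hl : l ≠ 0) {a b : k}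
    (h : a • (l ⊗ₜ[k] l) = b • (l ⊗ₜ[k] l)) : a = b :=
  smul_left_injective k (tmul_ne_zero_of_ne_zero (k := k) hl hl) h

/-- This is the Plücker relation in coordinates: on V₅ the quadrics carry no information beyond μ
and ε. -/
lemma q_eq_of_mem_V₅ {l : D.L} (hl : l ≠ 0) {τ : ⋀[k]^5 D.V₅ ≃ₗ[k] k}
    (hτ : ∀ z, D.ε z = τ z • (l ⊗ₜ[k] l)) (u : D.V₅) (w w' : D.W) :
    D.q u w w' = τ (wedge D.V₅ 3 2 5 rfl (vecWedge D.V₅ 2 3 rfl u (D.μAt l w)) (D.μAt l w')) := by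
  refine smul_tmul_injective hl ?_
  rw [D.q_plucker, vecWedge_wedge, hτ]
  rfl

lemma mem_W₁_iff {l : D.L} (hl : l ≠ 0) {w : D.W} : w ∈ D.W₁ ↔ D.μAt l w = 0 := by
  constructor
  · intro h
    exact LinearMap.congr_fun h l
  · intro h
    obtain ⟨e, he⟩ := exists_lineEquiv D.finrank_L hl
    refine LinearMap.ext fun l' => ?_
    change D.μ (l' ⊗ₜ w) = 0
    rw [he l', ← smul_tmul', map_smul, ← μAt_apply, h, smul_zero]

/-- On V₅ the quadrics factor through μ, which kills W₁. Pairing with W₁ thus depends only on the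
class of the vector modulo V₅, so a single v outside V₅ controls it. -/
lemma q_mem_V₅_mem_W₁ (u : D.V₅) {w : D.W} (hw : w ∈ D.W₁) (w' : D.W) : D.q u w w' = 0 := by
  obtain ⟨l, hl⟩ := exists_ne_zero_of_finrank_eq_one D.finrank_L
  obtain ⟨τ, hτ⟩ := exists_coordinate hl
  rw [q_eq_of_mem_V₅ hl hτ, (mem_W₁_iff hl).1 hw]
  simp

lemma IsLci.isCompl (h : D.IsLci) : IsCompl D.W₀ D.W₁ := by
  rcases h with h | ⟨h, h'⟩
  · rw [show D.W₁ = ⊥ from h, show D.W₀ = ⊤ from ?_]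
    · exact isCompl_top_bot
    · refine Submodule.eq_top_iff'.2 fun w v w₁ hw₁ => ?_
      rw [show D.W₁ = ⊥ from h, Submodule.mem_bot] at hw₁
      rw [hw₁, map_zero, LinearMap.zero_apply]
  · obtain ⟨v, hv⟩ := D.exists_notMem_V₅
    obtain ⟨⟨w₁, hw₁⟩, h0⟩ := exists_ne_zero_of_finrank_eq_one h
    obtain ⟨e, he⟩ := exists_lineEquiv h h0
    have h0' : w₁ ≠ 0 := fun h => h0 (Subtype.ext h)
    have hq := h' v hv w₁ hw₁ h0'
    have he' (x : D.W) (hx : x ∈ D.W₁) : ∃ a : k, x = a • w₁ :=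
      ⟨_, congrArg Subtype.val (he ⟨x, hx⟩)⟩
    refine ⟨Submodule.disjoint_def.2 fun x hx hx' => ?_, codisjoint_iff.2 ?_⟩
    · by_contra hx0
      exact h' v hv x hx' hx0 (hx v x hx')
    · refine Submodule.eq_top_iff'.2 fun w => ?_
      -- The coefficient of the orthogonal projection onto W₁ for q(v). It serves all forms at once,
      -- because those from V₅ vanish on W₁.
      let c := D.q v w₁ w / D.q v w₁ w₁
      refine Submodule.mem_sup.2 ⟨w - c • w₁, fun v' x hx => ?_, c • w₁,
        D.W₁.smul_mem c hw₁, by simp⟩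
      obtain ⟨a, u, rfl⟩ := D.exists_eq_smul_add_V₅ hv v'
      obtain ⟨b, rfl⟩ := he' x hx
      rw [map_add, LinearMap.add_apply, LinearMap.add_apply, q_mem_V₅_mem_W₁ u hx, add_zero]
      simp only [map_smul, map_sub, LinearMap.smul_apply, smul_eq_mul, c]
      field_simp
      simp

lemma IsLci.μAt_injective (h : D.IsLci) {l : D.L} (hl : l ≠ 0) :
    Function.Injective (D.μAt l ∘ₗ D.W₀.subtype) := by
  rw [injective_iff_map_eq_zero]
  intro w hw
  exact Subtype.ext (Submodule.disjoint_def.1 h.isCompl.disjoint w w.2 ((mem_W₁_iff hl).2 hw))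

lemma evenF₂_apply_zero {l : D.L} {τ : ⋀[k]^5 D.V₅ ≃ₗ[k] k}
    (hτ : ∀ z, D.ε z = τ z • (l ⊗ₜ[k] l)) (ξ : ⋀[k]^3 D.V₅) (w' : D.W₀) :
    D.evenF₂ (ξ, 0) (l ⊗ₜ w') = τ (wedge D.V₅ 3 2 5 rfl ξ (D.μAt l w')) • (l ⊗ₜ[k] l) := by
  simp [evenF₂, hτ, μAt_apply]

lemma evenF₂_zero_tmul (l : D.L) (v : D.V₆) (w w' : D.W₀) :
    D.evenF₂ (0, v ⊗ₜ (l ⊗ₜ w)) (l ⊗ₜ w') = D.q v w w' • (l ⊗ₜ[k] l) := by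
  simp [evenF₂, pairing_tmul]

lemma evenF₃_apply_zero (ξ : ⋀[k]^3 D.V₅) :
    D.evenF₃ (ξ, 0) = exteriorPower.map 3 D.V₅.subtype ξ := by
  simp [evenF₃]

lemma evenF₃_zero_tmul (l : D.L) (v : D.V₆) (w : D.W₀) :
    D.evenF₃ (0, v ⊗ₜ (l ⊗ₜ w)) =
      vecWedge D.V₆ 2 3 rfl v (exteriorPower.map 2 D.V₅.subtype (D.μAt l w)) := by
  simp [evenF₃, μAt_apply]

/-- Seen through f₂ and f₃, every tensor is equivalent to a pair (ξ, v ⊗ l ⊗ w): by the Plücker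
relation, u ⊗ l ⊗ w with u in V₅ has the same images as the trivector u∧μ(l ⊗ w). -/
lemma exists_evenF_zero_eq {v : D.V₆} (hv : v ∉ D.V₅) {l : D.L} (hl : l ≠ 0)
    {τ : ⋀[k]^5 D.V₅ ≃ₗ[k] k} (hτ : ∀ z, D.ε z = τ z • (l ⊗ₜ[k] l))
    (z : D.V₆ ⊗[k] (D.L ⊗[k] D.W₀)) :
    ∃ (ξ : ⋀[k]^3 D.V₅) (w : D.W₀),
      (∀ w', D.evenF₂ (0, z) (l ⊗ₜ w') =
        (τ (wedge D.V₅ 3 2 5 rfl ξ (D.μAt l w')) + D.q v w w') • (l ⊗ₜ[k] l)) ∧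
      D.evenF₃ (0, z) = wedgeSplit D.V₅ v (ξ, D.μAt l w) := by
  induction z using TensorProduct.induction_on with
  | zero =>
    refine ⟨0, 0, fun w' => ?_, ?_⟩
    · rw [Prod.mk_zero_zero, map_zero]
      simp
    · rw [Prod.mk_zero_zero, map_zero, ZeroMemClass.coe_zero, map_zero, Prod.mk_zero_zero,
        map_zero]
  | add a b ha hb =>
    obtain ⟨ξ, w, h, h'⟩ := ha
    obtain ⟨ξ', w', h₁, h₁'⟩ := hb
    have hab : ((0 : ⋀[k]^3 D.V₅), a + b) = (0, a) + (0, b) := by simp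
    refine ⟨ξ + ξ', w + w', fun w'' => ?_, ?_⟩
    · rw [hab, map_add, LinearMap.add_apply, h, h₁, ← add_smul]
      simp only [map_add, LinearMap.add_apply, Submodule.coe_add]
      congr 1
      ring
    · rw [hab, map_add, h', h₁', ← map_add, Prod.mk_add_mk, Submodule.coe_add, map_add]
  | tmul x y =>
    obtain ⟨w, rfl⟩ := exists_eq_tmul_of_finrank_eq_one D.finrank_L hl y
    obtain ⟨a, u, rfl⟩ := D.exists_eq_smul_add_V₅ hv x
    refine ⟨vecWedge D.V₅ 2 3 rfl u (D.μAt l w), a • w, fun w' => ?_, ?_⟩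
    · rw [evenF₂_zero_tmul, ← q_eq_of_mem_V₅ hl hτ]
      simp [add_comm]
    · rw [evenF₃_zero_tmul, vecWedge_add_eq_wedgeSplit, Submodule.coe_smul, map_smul]

/-- The bridge between the intrinsic A and coordinates. The left side involves none of v, l and τ,
so each later argument may choose them to suit. -/
lemma A_eq_graphLagrangian {v : D.V₆} (hv : v ∉ D.V₅) {l : D.L} (hl : l ≠ 0)
    {τ : ⋀[k]^5 D.V₅ ≃ₗ[k] k} (hτ : ∀ z, D.ε z = τ z • (l ⊗ₜ[k] l)) :
    D.A = graphLagrangian v τ (D.μAt l ∘ₗ D.W₀.subtype) (D.q₀ v) := by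
  ext x
  constructor
  · rintro ⟨⟨ξ, z⟩, h, rfl⟩
    obtain ⟨ξ', w, hz, hz'⟩ := exists_evenF_zero_eq hv hl hτ z
    have hadd : (ξ, z) = (ξ, 0) + (0, z) := by simp
    refine ⟨ξ + ξ', w, fun w' => ?_, ?_⟩
    · have h' : D.evenF₂ (ξ, z) (l ⊗ₜ w') = 0 := LinearMap.congr_fun h _
      rw [hadd, map_add, LinearMap.add_apply, evenF₂_apply_zero hτ, hz, ← add_smul,
        smul_eq_zero, or_iff_left (tmul_ne_zero_of_ne_zero (k := k) hl hl), ← add_assoc] at h'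
      simpa [q₀_apply] using h'
    · rw [hadd, map_add, evenF₃_apply_zero, hz', wedgeSplit_apply, wedgeSplit_apply, map_add,
        add_assoc]
      rfl
  · rintro ⟨ξ, w, h, rfl⟩
    have hadd : (ξ, v ⊗ₜ[k] (l ⊗ₜ[k] w)) = (ξ, 0) + (0, v ⊗ₜ[k] (l ⊗ₜ[k] w)) := by simp
    refine ⟨(ξ, v ⊗ₜ (l ⊗ₜ w)), ?_, ?_⟩
    · refine LinearMap.ext fun y => ?_
      obtain ⟨w', rfl⟩ := exists_eq_tmul_of_finrank_eq_one D.finrank_L hl y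
      rw [hadd, map_add, LinearMap.add_apply, evenF₂_apply_zero hτ, evenF₂_zero_tmul,
        ← add_smul]
      exact smul_eq_zero_of_left (h w') _
    · rw [hadd, map_add, evenF₃_apply_zero, evenF₃_zero_tmul]
      rfl

lemma IsLci.isLagrangian_A (h : D.IsLci) : IsLagrangian (wedge D.V₆ 3 3 6 rfl) D.A := by
  obtain ⟨v, hv⟩ := D.exists_notMem_V₅
  obtain ⟨l, hl⟩ := exists_ne_zero_of_finrank_eq_one D.finrank_L
  obtain ⟨τ, hτ⟩ := exists_coordinate hl
  rw [A_eq_graphLagrangian hv hl hτ]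
  exact isLagrangian_graphLagrangian D.finrank_V₆ D.finrank_V₅ hv τ (h.μAt_injective hl)
    fun w w' => D.q_symm v w w'

namespace Iso

variable {E : GMData k} (f : Iso D E)

lemma wedgeRestrict_μAt (l : D.L) (w : D.W) :
    wedgeRestrict 2 f.φV D.V₅ E.V₅ f.map_V₅ (D.μAt l w) = E.μAt (f.φL l) (f.φW w) := by
  rw [μAt_apply, f.map_μ]
  rfl

lemma mem_W₁_iff (w : D.W) : f.φW w ∈ E.W₁ ↔ w ∈ D.W₁ := by
  obtain ⟨l, hl⟩ := exists_ne_zero_of_finrank_eq_one D.finrank_L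
  rw [GMData.mem_W₁_iff hl, GMData.mem_W₁_iff (f.φL.map_ne_zero_iff.2 hl), ← f.wedgeRestrict_μAt,
    ← wedgeRestrictEquiv_apply, LinearEquiv.map_eq_zero_iff]

lemma map_mem_W₀ {w : D.W} (hw : w ∈ D.W₀) : f.φW w ∈ E.W₀ := by
  intro v w₁ hw₁
  obtain ⟨v, rfl⟩ := f.φV.surjective v
  obtain ⟨w₁, rfl⟩ := f.φW.surjective w₁
  rw [f.map_q]
  exact hw v w₁ ((f.mem_W₁_iff w₁).1 hw₁)

lemma coordinate_wedgeRestrict {l : D.L} (hl : l ≠ 0)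
    {τ : ⋀[k]^5 D.V₅ ≃ₗ[k] k} (hτ : ∀ z, D.ε z = τ z • (l ⊗ₜ[k] l))
    {τ' : ⋀[k]^5 E.V₅ ≃ₗ[k] k} (hτ' : ∀ z, E.ε z = τ' z • (f.φL l ⊗ₜ[k] f.φL l))
    (x : ⋀[k]^5 D.V₅) : τ' (wedgeRestrict 5 f.φV D.V₅ E.V₅ f.map_V₅ x) = τ x := by
  refine smul_tmul_injective (f.φL.map_ne_zero_iff.2 hl) ?_
  rw [← hτ', f.map_ε, hτ, map_smul]
  rfl

/-- With v, l and τ transported along the isomorphism, the two graph descriptions match term by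
term. The reverse inclusion comes from the inverse isomorphism. -/
lemma map_A_le : D.A.map (exteriorPower.map 3 (f.φV : D.V₆ →ₗ[k] E.V₆)) ≤ E.A := by
  obtain ⟨v, hv⟩ := D.exists_notMem_V₅
  obtain ⟨l, hl⟩ := exists_ne_zero_of_finrank_eq_one D.finrank_L
  have hl' := f.φL.map_ne_zero_iff.2 hl
  obtain ⟨τ, hτ⟩ := exists_coordinate hl
  obtain ⟨τ', hτ'⟩ := exists_coordinate hl'
  rw [A_eq_graphLagrangian hv hl hτ,
    A_eq_graphLagrangian (apply_notMem_of_map_eq f.map_V₅ hv) hl' hτ',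
    Submodule.map_le_iff_le_comap]
  rintro _ ⟨ξ, w, h, rfl⟩
  refine ⟨wedgeRestrict 3 f.φV D.V₅ E.V₅ f.map_V₅ ξ, ⟨f.φW w, f.map_mem_W₀ w.2⟩,
    fun w' => ?_, ?_⟩
  rotate_left
  · rw [map_wedgeSplit f.φV f.map_V₅, LinearMap.comp_apply, LinearMap.comp_apply,
      Submodule.subtype_apply, Submodule.subtype_apply, f.wedgeRestrict_μAt]
  · have hw' : f.φW.symm w' ∈ D.W₀ := f.symm.map_mem_W₀ w'.2
    have h' := h ⟨_, hw'⟩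
    rw [← f.coordinate_wedgeRestrict hl hτ hτ', wedgeRestrict_wedge, LinearMap.comp_apply,
      Submodule.subtype_apply, f.wedgeRestrict_μAt, q₀_apply, ← f.map_q] at h'
    simpa [q₀_apply] using h'

lemma map_A : D.A.map (exteriorPower.map 3 (f.φV : D.V₆ →ₗ[k] E.V₆)) = E.A := by
  refine le_antisymm f.map_A_le ?_
  rw [← wedge_map_symm (A := E.A) (φ := f.φV.symm) rfl]
  exact Submodule.map_mono f.symm.map_A_le

end Iso

end GMData

/-! ### Rescaling isomorphisms -/

section Scaling

variable {k : Type u} [Field k] {V V' : Type u} [AddCommGroup V] [Module k V]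
  [AddCommGroup V'] [Module k V']

lemma exteriorPower_map_smul (p : ℕ) (a : k) (f : V →ₗ[k] V') :
    exteriorPower.map p (a • f) = a ^ p • exteriorPower.map p f := by
  ext v
  have := congrArg (Subtype.val) ((exteriorPower.ιMulti k p).map_smul_univ (fun _ => a) (f ∘ v))
  simpa [Function.comp_def] using this

/-- The multiple of a linear isomorphism by a nonzero scalar. -/
def scaleEquiv (φ : V ≃ₗ[k] V') {a : k} (ha : a ≠ 0) : V ≃ₗ[k] V' :=
  φ.trans (LinearEquiv.smulOfNeZero k V' a ha)

lemma coe_scaleEquiv (φ : V ≃ₗ[k] V') {a : k} (ha : a ≠ 0) :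
    (scaleEquiv φ ha : V →ₗ[k] V') = a • (φ : V →ₗ[k] V') := rfl

lemma submodule_map_scaleEquiv (φ : V ≃ₗ[k] V') {a : k} (ha : a ≠ 0) (U : Submodule k V) :
    U.map (scaleEquiv φ ha : V →ₗ[k] V') = U.map (φ : V →ₗ[k] V') := by
  rw [coe_scaleEquiv, Submodule.map_smul _ _ _ ha]

lemma submodule_map_exteriorPower_scaleEquiv (φ : V ≃ₗ[k] V') {a : k} (ha : a ≠ 0) (p : ℕ)
    (A : Submodule k (⋀[k]^p V)) :
    A.map (exteriorPower.map p (scaleEquiv φ ha : V →ₗ[k] V')) =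
      A.map (exteriorPower.map p (φ : V →ₗ[k] V')) := by
  rw [coe_scaleEquiv, exteriorPower_map_smul, Submodule.map_smul _ _ _ (pow_ne_zero p ha)]

lemma wedgeRestrict_scaleEquiv (p : ℕ) (φ : V ≃ₗ[k] V') {a : k} (ha : a ≠ 0)
    (U : Submodule k V) (U' : Submodule k V') (h h') (x : ⋀[k]^p U) :
    wedgeRestrict p (scaleEquiv φ ha) U U' h x = a ^ p • wedgeRestrict p φ U U' h' x := by
  have : ((scaleEquiv φ ha).ofSubmodules U U' h : U →ₗ[k] U') =
      a • (φ.ofSubmodules U U' h' : U →ₗ[k] U') := rfl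
  rw [wedgeRestrict, this, exteriorPower_map_smul]
  rfl

end Scaling

/-! ### Recovering the GM data from A -/

namespace GMData

variable {k : Type u} [Field k] {D E : GMData k}

/-- An isomorphism of the spaces `V₆` and `V₅` compatible with the Lagrangian subspaces identifies
the spaces `μ(L ⊗ W₀)`. -/
lemma exists_equiv_W₀ (hD : D.IsLci) (hE : E.IsLci) (φV : D.V₆ ≃ₗ[k] E.V₆)
    (hV : D.V₅.map (φV : D.V₆ →ₗ[k] E.V₆) = E.V₅)
    (hA : D.A.map (exteriorPower.map 3 (φV : D.V₆ →ₗ[k] E.V₆)) = E.A)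
    {l : D.L} (hl : l ≠ 0) {l' : E.L} (hl' : l' ≠ 0) :
    ∃ ψ : D.W₀ ≃ₗ[k] E.W₀, ∀ w : D.W₀,
      E.μAt l' (ψ w) = wedgeRestrict 2 φV D.V₅ E.V₅ hV (D.μAt l w) := by
  obtain ⟨v, hv⟩ := D.exists_notMem_V₅
  obtain ⟨τ, hτ⟩ := exists_coordinate hl
  obtain ⟨τ', hτ'⟩ := exists_coordinate hl'
  have hv' := apply_notMem_of_map_eq hV hv
  have h := map_wedgeProj φV hV v D.A
  rw [hA, A_eq_graphLagrangian hv hl hτ, A_eq_graphLagrangian hv' hl' hτ',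
    wedgeProj_graphLagrangian D.finrank_V₅ hv τ (hD.μAt_injective hl),
    wedgeProj_graphLagrangian E.finrank_V₅ hv' τ' (hE.μAt_injective hl')] at h
  refine ⟨(LinearEquiv.ofInjective _ (hD.μAt_injective hl)).trans
    (((wedgeRestrictEquiv φV hV 2).ofSubmodules _ _ h).trans
      (LinearEquiv.ofInjective _ (hE.μAt_injective hl')).symm), fun w => ?_⟩
  exact congrArg Subtype.val ((LinearEquiv.ofInjective _ (hE.μAt_injective hl')).apply_symm_apply
    ((wedgeRestrictEquiv φV hV 2).ofSubmodules _ _ h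
      (LinearEquiv.ofInjective _ (hD.μAt_injective hl) w)))

/-- An isomorphism of the spaces `V₆` and `V₅` compatible with the Lagrangian subspaces and with
the forms on `W₁` extends to an isomorphism of GM data. -/
lemma exists_iso (hD : D.IsLci) (hE : E.IsLci) (φV : D.V₆ ≃ₗ[k] E.V₆)
    (hV : D.V₅.map (φV : D.V₆ →ₗ[k] E.V₆) = E.V₅)
    (hA : D.A.map (exteriorPower.map 3 (φV : D.V₆ →ₗ[k] E.V₆)) = E.A)
    (φL : D.L ≃ₗ[k] E.L)
    (hε : ∀ x, E.ε (wedgeRestrict 5 φV D.V₅ E.V₅ hV x) =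
      TensorProduct.map (φL : D.L →ₗ[k] E.L) (φL : D.L →ₗ[k] E.L) (D.ε x))
    (ψ₁ : D.W₁ ≃ₗ[k] E.W₁)
    (hψ₁ : ∀ v ∉ D.V₅, ∀ w w' : D.W₁, E.q (φV v) (ψ₁ w) (ψ₁ w') = D.q v w w') :
    Nonempty (Iso D E) := by
  obtain ⟨v, hv⟩ := D.exists_notMem_V₅
  obtain ⟨l, hl⟩ := exists_ne_zero_of_finrank_eq_one D.finrank_L
  have hl' := φL.map_ne_zero_iff.2 hl
  obtain ⟨τ, hτ⟩ := exists_coordinate hl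
  obtain ⟨τ', hτ'⟩ := exists_coordinate hl'
  have hv' := apply_notMem_of_map_eq hV hv
  have hττ (x : ⋀[k]^5 D.V₅) : τ' (wedgeRestrict 5 φV D.V₅ E.V₅ hV x) = τ x := by
    refine smul_tmul_injective hl' ?_
    rw [← hτ', hε, hτ, map_smul]
    rfl
  obtain ⟨ψ₀, hψ₀⟩ := exists_equiv_W₀ hD hE φV hV hA hl hl'
  -- A point ξ + v∧μ(l ⊗ w) of A determines q(v)(w, ·) on W₀. Its image lies in the other Lagrangian
  -- and determines the corresponding form there.
  have hq₀ (w w' : D.W₀) : E.q (φV v) (ψ₀ w) (ψ₀ w') = D.q v w w' := by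
    have hw : D.μAt l w ∈ wedgeProj D.V₅ v D.A := by
      rw [A_eq_graphLagrangian hv hl hτ,
        wedgeProj_graphLagrangian D.finrank_V₅ hv τ (hD.μAt_injective hl)]
      exact ⟨w, rfl⟩
    obtain ⟨ξ, hξ⟩ := mem_wedgeProj.1 hw
    have hξ' : wedgeSplit E.V₅ (φV v) (wedgeRestrict 3 φV D.V₅ E.V₅ hV ξ,
        (E.μAt (φL l) ∘ₗ E.W₀.subtype) (ψ₀ w)) ∈ E.A := by
      rw [LinearMap.comp_apply, Submodule.subtype_apply, hψ₀, ← map_wedgeSplit, ← hA]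
      exact Submodule.mem_map_of_mem hξ
    rw [A_eq_graphLagrangian hv hl hτ] at hξ
    rw [A_eq_graphLagrangian hv' hl' hτ'] at hξ'
    have h := eq_of_wedgeSplit_mem_graphLagrangian hv (hD.μAt_injective hl) hξ w'
    have h' := eq_of_wedgeSplit_mem_graphLagrangian hv' (hE.μAt_injective hl') hξ' (ψ₀ w')
    rw [LinearMap.comp_apply, Submodule.subtype_apply, hψ₀, ← wedgeRestrict_wedge, hττ,
      q₀_apply] at h'
    rw [LinearMap.comp_apply, Submodule.subtype_apply, q₀_apply] at h
    exact add_left_cancel (h'.trans h.symm)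
  let eD := Submodule.prodEquivOfIsCompl _ _ hD.isCompl
  let eE := Submodule.prodEquivOfIsCompl _ _ hE.isCompl
  let φW : D.W ≃ₗ[k] E.W := eD.symm.trans ((ψ₀.prodCongr ψ₁).trans eE)
  have hφW (w₀ : D.W₀) (w₁ : D.W₁) : φW (w₀ + w₁) = ψ₀ w₀ + ψ₁ w₁ := by
    have : (w₀ + w₁ : D.W) = eD (w₀, w₁) := rfl
    rw [this]
    simp only [φW, LinearEquiv.trans_apply, LinearEquiv.symm_apply_apply]
    rfl
  have hdec (w : D.W) : ∃ (w₀ : D.W₀) (w₁ : D.W₁), w = w₀ + w₁ := by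
    obtain ⟨⟨w₀, w₁⟩, h⟩ := eD.surjective w
    exact ⟨w₀, w₁, h.symm⟩
  have hμ (w : D.W) : wedgeRestrict 2 φV D.V₅ E.V₅ hV (D.μAt l w) = E.μAt (φL l) (φW w) := by
    obtain ⟨w₀, w₁, rfl⟩ := hdec w
    rw [hφW, map_add, map_add, map_add, hψ₀, (mem_W₁_iff hl).1 w₁.2,
      (mem_W₁_iff hl').1 (ψ₁ w₁).2, map_zero]
  refine ⟨⟨φW, φV, φL, hV, hε, fun x w w' => ?_, fun x => ?_⟩⟩
  · obtain ⟨a, u, rfl⟩ := D.exists_eq_smul_add_V₅ hv x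
    -- On V₅ both sides are forced by the Plücker relation, so compatibility with μ and τ is enough.
    have hu : E.q (φV u) (φW w) (φW w') = D.q u w w' := by
      have h1 := q_eq_of_mem_V₅ hl hτ u w w'
      have h2 := q_eq_of_mem_V₅ hl' hτ' (φV.ofSubmodules _ _ hV u) (φW w) (φW w')
      rw [← hμ, ← hμ, wedgeRestrict, ← LinearEquiv.coe_coe (φV.ofSubmodules _ _ hV),
        ← map_vecWedge, ← map_wedge] at h2
      rw [h1, ← hττ]
      exact h2
    -- The cross terms vanish, W₀ being orthogonal to W₁ on both sides; the blocks are handled by ψ₀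
    -- and ψ₁.
    have h0 : E.q (φV v) (φW w) (φW w') = D.q v w w' := by
      obtain ⟨w₀, w₁, rfl⟩ := hdec w
      obtain ⟨w₀', w₁', rfl⟩ := hdec w'
      rw [hφW, hφW]
      simp only [map_add, LinearMap.add_apply]
      rw [hq₀, hψ₁ v hv, w₀'.2 v w₁ w₁.2, (ψ₀ w₀').2 (φV v) (ψ₁ w₁) (ψ₁ w₁).2,
        D.q_symm v w₀ w₁', w₀.2 v w₁' w₁'.2, E.q_symm (φV v) (ψ₀ w₀) (ψ₁ w₁'),
        (ψ₀ w₀).2 (φV v) (ψ₁ w₁') (ψ₁ w₁').2]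
    simp only [map_add, map_smul, LinearMap.add_apply, LinearMap.smul_apply, hu, h0]
  · obtain ⟨w, rfl⟩ := exists_eq_tmul_of_finrank_eq_one D.finrank_L hl x
    exact hμ w

/-- An isomorphism of the spaces `V₆` and `V₅` may be rescaled in such a way that it is compatible
with the isomorphisms `ε`. -/
lemma exists_scale (φV : D.V₆ ≃ₗ[k] E.V₆) (hV : D.V₅.map (φV : D.V₆ →ₗ[k] E.V₆) = E.V₅) :
    ∃ (a : k) (ha : a ≠ 0) (φL : D.L ≃ₗ[k] E.L), ∀ x,
      E.ε (wedgeRestrict 5 (scaleEquiv φV ha) D.V₅ E.V₅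
        ((submodule_map_scaleEquiv φV ha _).trans hV) x) =
      TensorProduct.map (φL : D.L →ₗ[k] E.L) (φL : D.L →ₗ[k] E.L) (D.ε x) := by
  obtain ⟨l, hl⟩ := exists_ne_zero_of_finrank_eq_one D.finrank_L
  obtain ⟨l', hl'⟩ := exists_ne_zero_of_finrank_eq_one E.finrank_L
  obtain ⟨τ, hτ⟩ := exists_coordinate hl
  obtain ⟨τ', hτ'⟩ := exists_coordinate hl'
  let g : k ≃ₗ[k] k := τ.symm.trans ((wedgeRestrictEquiv φV hV 5).trans τ')
  have hg (x : ⋀[k]^5 D.V₅) : τ' (wedgeRestrict 5 φV D.V₅ E.V₅ hV x) = g 1 * τ x := by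
    have h1 : g (τ x) = τ' (wedgeRestrict 5 φV D.V₅ E.V₅ hV x) := by simp [g]
    rw [← h1, mul_comm, ← smul_eq_mul, ← map_smul, smul_eq_mul, mul_one]
  have ha : g 1 ≠ 0 := g.map_ne_zero_iff.2 one_ne_zero
  -- Let c = `g 1` be the factor by which φ_V fails to match the coordinates. Scaling φ_V by c
  -- contributes c⁵, so the total factor is c⁶ = (c³)², which sending l to c³l' absorbs. No square
  -- root is needed.
  obtain ⟨φL, hφL⟩ := exists_equiv_of_finrank_eq_one D.finrank_L E.finrank_L hl
    (smul_ne_zero (pow_ne_zero 3 ha) hl')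
  refine ⟨g 1, ha, φL, fun x => ?_⟩
  rw [wedgeRestrict_scaleEquiv 5 φV ha _ _ _ hV, map_smul, hτ', hg, hτ, map_smul,
    TensorProduct.map_tmul, LinearEquiv.coe_coe, hφL, smul_tmul_smul, smul_smul, smul_smul]
  congr 1
  ring

lemma IsLci.finrank_W₁ (h : D.IsLci) (h' : ¬ D.IsOrdinary) : Module.finrank k D.W₁ = 1 :=
  (h.resolve_left h').1

lemma IsLci.q_ne_zero (h : D.IsLci) {v : D.V₆} (hv : v ∉ D.V₅) {w : D.W₁} (hw : w ≠ 0) :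
    D.q v w w ≠ 0 := by
  rcases h with h | h
  · refine absurd (Subtype.ext ?_) hw
    exact (Submodule.mem_bot k).1 (h ▸ w.2 : (w : D.W) ∈ (⊥ : Submodule k D.W))
  · exact h.2 v hv w w.2 fun h => hw (Subtype.ext h)

/-- The values of `q` on `W₁` vanish on `V₅`. -/
lemma q_smul_add_W₁ (a : k) (v : D.V₆) (u : D.V₅) (w w' : D.W₁) :
    D.q (a • v + u) w w' = a * D.q v w w' := by
  simp [q_mem_V₅_mem_W₁ u w.2]

/-- Two nonzero quadratic forms on lines are isometric when the ratio of their values is a square.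
One v suffices, since on W₁ the other forms are multiples of q(v). -/
lemma exists_equiv_W₁ (hk : ∀ a : k, IsSquare a) (hD : D.IsLci) (hE : E.IsLci)
    (h : ¬ D.IsOrdinary) (h' : ¬ E.IsOrdinary) (φV : D.V₆ ≃ₗ[k] E.V₆)
    (hV : D.V₅.map (φV : D.V₆ →ₗ[k] E.V₆) = E.V₅) :
    ∃ ψ₁ : D.W₁ ≃ₗ[k] E.W₁, ∀ v ∉ D.V₅, ∀ w w' : D.W₁,
      E.q (φV v) (ψ₁ w) (ψ₁ w') = D.q v w w' := by
  obtain ⟨v, hv⟩ := D.exists_notMem_V₅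
  have hv' := apply_notMem_of_map_eq hV hv
  obtain ⟨w, hw⟩ := exists_ne_zero_of_finrank_eq_one (hD.finrank_W₁ h)
  obtain ⟨w', hw'⟩ := exists_ne_zero_of_finrank_eq_one (hE.finrank_W₁ h')
  obtain ⟨e, he⟩ := exists_lineEquiv (hD.finrank_W₁ h) hw
  obtain ⟨c, hc⟩ := hk (D.q v w w / E.q (φV v) w' w')
  have hq := hD.q_ne_zero hv hw
  have hq' := hE.q_ne_zero hv' hw'
  have hc0 : c ≠ 0 := by
    rintro rfl
    simp [hq, hq'] at hc
  obtain ⟨ψ₁, hψ₁⟩ := exists_equiv_of_finrank_eq_one (hD.finrank_W₁ h) (hE.finrank_W₁ h') hw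
    (smul_ne_zero hc0 hw')
  refine ⟨ψ₁, fun x _ y y' => ?_⟩
  obtain ⟨a, u, rfl⟩ := D.exists_eq_smul_add_V₅ hv x
  have hu : φV (a • v + u) = a • φV v + (φV.ofSubmodules _ _ hV u : E.V₅) := by
    rw [map_add, map_smul]
    rfl
  rw [div_eq_iff hq'] at hc
  rw [hu, q_smul_add_W₁, q_smul_add_W₁, he y, he y', map_smul, map_smul, hψ₁]
  simp only [Submodule.coe_smul, map_smul, LinearMap.smul_apply, smul_eq_mul, hc]
  ring

/-- Ordinary GM data with isomorphic Lagrangian data are isomorphic. -/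
lemma nonempty_iso_of_isOrdinary (hD : D.IsOrdinary) (hE : E.IsOrdinary)
    (φV : D.V₆ ≃ₗ[k] E.V₆) (hV : D.V₅.map (φV : D.V₆ →ₗ[k] E.V₆) = E.V₅)
    (hA : D.A.map (exteriorPower.map 3 (φV : D.V₆ →ₗ[k] E.V₆)) = E.A) : Nonempty (Iso D E) := by
  obtain ⟨a, ha, φL, hφL⟩ := exists_scale φV hV
  have hD₁ : Subsingleton D.W₁ := by
    rw [show D.W₁ = ⊥ from hD]
    infer_instance
  have hE₁ : Subsingleton E.W₁ := by
    rw [show E.W₁ = ⊥ from hE]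
    infer_instance
  refine exists_iso (Or.inl hD) (Or.inl hE) (scaleEquiv φV ha) _
    ((submodule_map_exteriorPower_scaleEquiv φV ha 3 _).trans hA) φL hφL 0 fun v _ w w' => ?_
  rw [Subsingleton.elim w 0]
  simp

/-- Over a quadratically closed field, lci GM data of the same type with isomorphic Lagrangian
data are isomorphic. -/
lemma nonempty_iso_of_isLci (hk : ∀ a : k, IsSquare a) (hD : D.IsLci) (hE : E.IsLci)
    (h : D.IsOrdinary ↔ E.IsOrdinary)
    (φV : D.V₆ ≃ₗ[k] E.V₆) (hV : D.V₅.map (φV : D.V₆ →ₗ[k] E.V₆) = E.V₅)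
    (hA : D.A.map (exteriorPower.map 3 (φV : D.V₆ →ₗ[k] E.V₆)) = E.A) : Nonempty (Iso D E) := by
  by_cases hO : D.IsOrdinary
  · exact nonempty_iso_of_isOrdinary hO (h.1 hO) φV hV hA
  · obtain ⟨a, ha, φL, hφL⟩ := exists_scale φV hV
    obtain ⟨ψ₁, hψ₁⟩ := exists_equiv_W₁ hk hD hE hO (fun h' => hO (h.2 h')) (scaleEquiv φV ha)
      ((submodule_map_scaleEquiv φV ha _).trans hV)
    exact exists_iso hD hE (scaleEquiv φV ha) _
      ((submodule_map_exteriorPower_scaleEquiv φV ha 3 _).trans hA) φL hφL ψ₁ hψ₁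

end GMData

/-! ### From a Lagrangian data to a GM data -/

lemma wedge_vecWedge_comm {k : Type u} [Field k] {V : Type u} [AddCommGroup V] [Module k V]
    (v : V) (x y : ⋀[k]^2 V) :
    wedge V 3 2 5 rfl (vecWedge V 2 3 rfl v x) y =
      wedge V 3 2 5 rfl (vecWedge V 2 3 rfl v y) x := by
  rw [← vecWedge_wedge, ← vecWedge_wedge, wedge_two_comm]

/-- The projection of C to N is surjective onto its image, hence has a linear section; the image is
given coordinates so that it can be part of the new space W. -/
lemma exists_linear_lift {k : Type u} [Field k] {M N : Type u} [AddCommGroup M] [Module k M]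
    [AddCommGroup N] [Module k N] [FiniteDimensional k N] (C : Submodule k (M × N)) :
    ∃ (n : ℕ) (incl : (Fin n → k) →ₗ[k] N) (lift : (Fin n → k) →ₗ[k] M),
      Function.Injective incl ∧ (∀ x y, (x, y) ∈ C → ∃ a, incl a = y) ∧
        ∀ a, (lift a, incl a) ∈ C := by
  obtain ⟨s, hs⟩ := LinearMap.exists_rightInverse_of_surjective
    ((LinearMap.snd k M N).submoduleMap C)
    (LinearMap.range_eq_top.2 (LinearMap.submoduleMap_surjective _ _))
  let e := (Module.finBasis k (C.map (LinearMap.snd k M N))).equivFun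
  refine ⟨_, Submodule.subtype _ ∘ₗ e.symm.toLinearMap,
    LinearMap.fst k M N ∘ₗ C.subtype ∘ₗ s ∘ₗ e.symm.toLinearMap,
    Subtype.val_injective.comp e.symm.injective, fun x y h => ?_, fun a => ?_⟩
  · exact ⟨e ⟨y, ⟨_, h, rfl⟩⟩, congrArg Subtype.val (e.symm_apply_apply _)⟩
  · have h := congrArg Subtype.val (LinearMap.congr_fun hs (e.symm a))
    have h' := (s (e.symm a)).2
    convert h' using 1
    exact Prod.ext rfl h.symm

namespace LagrangianData

variable {k : Type u} [Field k] (X : LagrangianData k)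

lemma exists_notMem_V₅ : ∃ v, v ∉ X.V₅ :=
  exists_notMem_of_finrank_lt (k := k) (by rw [X.finrank_V₅, X.finrank_V₆]; norm_num)

/-- The auxiliary choices that identify a Lagrangian data `(V₆, V₅, A)` with the Lagrangian data of
a GM data: a splitting `V₆ = k v ⊕ V₅`, a coordinate on `⋀^5 V₅` and a linear lift to `A` of the
projection of `A` to `⋀^2 V₅`. -/
structure Splitting where
  v : X.V₆
  v_notMem : v ∉ X.V₅
  toV₅ : X.V₆ →ₗ[k] X.V₅
  toV₅_coe : ∀ u : X.V₅, toV₅ u = u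
  toV₅_v : toV₅ v = 0
  coord : X.V₆ →ₗ[k] k
  coord_eq_zero_iff : ∀ x, coord x = 0 ↔ x ∈ X.V₅
  coord_v : coord v = 1
  τ : ⋀[k]^5 X.V₅ ≃ₗ[k] k
  n : ℕ
  incl : (Fin n → k) →ₗ[k] ⋀[k]^2 X.V₅
  lift : (Fin n → k) →ₗ[k] ⋀[k]^3 X.V₅
  incl_injective : Function.Injective incl
  exists_incl_eq : ∀ ξ η, wedgeSplit X.V₅ v (ξ, η) ∈ X.A → ∃ a, incl a = η
  lift_mem : ∀ a, wedgeSplit X.V₅ v (lift a, incl a) ∈ X.A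

lemma nonempty_splitting : Nonempty X.Splitting := by
  obtain ⟨v, hv⟩ := X.exists_notMem_V₅
  obtain ⟨r, hr, hrv⟩ := LinearMap.exists_extend_of_notMem LinearMap.id hv 0
  obtain ⟨c, hc, hcv⟩ := LinearMap.exists_extend_of_notMem (0 : X.V₅ →ₗ[k] k) hv 1
  have hc' (u : X.V₅) : c u = 0 := LinearMap.congr_fun hc u
  have : FiniteDimensional k X.V₅ :=
    Module.finite_of_finrank_pos (by rw [X.finrank_V₅]; norm_num)
  have h5 : Module.finrank k (⋀[k]^5 X.V₅) = 1 := by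
    rw [exteriorPower.finrank_eq, X.finrank_V₅]
    rfl
  obtain ⟨z, hz⟩ := exists_ne_zero_of_finrank_eq_one h5
  obtain ⟨τ, -⟩ := exists_lineEquiv h5 hz
  obtain ⟨n, incl, lift, h1, h2, h3⟩ := exists_linear_lift (X.A.comap (wedgeSplit X.V₅ v))
  refine ⟨⟨v, hv, r, fun u => LinearMap.congr_fun hr u, hrv, c, fun x => ⟨fun hx => ?_, fun hx =>
    hc' ⟨x, hx⟩⟩, hcv, τ, n, incl, lift, h1, h2, h3⟩⟩
  obtain ⟨a, u, rfl⟩ := exists_eq_smul_add (by rw [X.finrank_V₅, X.finrank_V₆]) hv x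
  rw [map_add, hc', map_smul, hcv, add_zero, smul_eq_mul, mul_one] at hx
  simp [hx]

namespace Splitting

variable {X} (S : X.Splitting) (P : Submodule k k)

/-- The isotropy of A, evaluated on two lifts, is what makes q(v) symmetric. -/
lemma τ_lift_comm (a b : Fin S.n → k) :
    S.τ (wedge X.V₅ 3 2 5 rfl (S.lift a) (S.incl b)) =
      S.τ (wedge X.V₅ 3 2 5 rfl (S.lift b) (S.incl a)) := by
  rw [← wedge_wedgeSplit_eq_zero_iff X.finrank_V₅ S.v_notMem]
  exact (X.isLagrangian_A _).1 (S.lift_mem b) _ (S.lift_mem a)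

/-- The underlying space of the GM data attached to `A`, with `W₁ = P`. -/
abbrev W : Type u := (Fin S.n → k) × P

/-- The projection from `W` to `⋀^2 V₅`. -/
def proj : S.W P →ₗ[k] ⋀[k]^2 X.V₅ := S.incl ∘ₗ LinearMap.fst k _ P

/-- The bilinear map `(ξ, w) ↦ τ(ξ ∧ w)`. -/
def wedgeW : ⋀[k]^3 X.V₅ →ₗ[k] S.W P →ₗ[k] k :=
  ((wedge X.V₅ 3 2 5 rfl).compr₂ S.τ.toLinearMap).compl₂ (S.proj P)

/-- The form `q(v)` on `W`. -/
def qv : S.W P →ₗ[k] S.W P →ₗ[k] k :=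
  -- The sign is the one in the graph equation τ(ξ∧m(w')) + B(w, w') = 0. The other summand is the
  -- multiplication form on P ⊆ k, nondegenerate when P = k.
  -(S.wedgeW P ∘ₗ S.lift ∘ₗ LinearMap.fst k _ P) +
    (LinearMap.mul k k).compl₁₂ (P.subtype ∘ₗ LinearMap.snd k _ P)
      (P.subtype ∘ₗ LinearMap.snd k _ P)

/-- The quadrics of the GM data attached to `A`, with `W₁ = P`. -/
def q : X.V₆ →ₗ[k] S.W P →ₗ[k] S.W P →ₗ[k] k :=
  ((vecWedge X.V₅ 2 3 rfl).compl₂ (S.proj P)).compr₂ (S.wedgeW P) ∘ₗ S.toV₅ +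
    S.coord.smulRight (S.qv P)

lemma q_apply (x : X.V₆) (w w' : S.W P) :
    S.q P x w w' =
      S.τ (wedge X.V₅ 3 2 5 rfl (vecWedge X.V₅ 2 3 rfl (S.toV₅ x) (S.incl w.1))
          (S.incl w'.1)) +
        S.coord x * (-S.τ (wedge X.V₅ 3 2 5 rfl (S.lift w.1) (S.incl w'.1)) + w.2 * w'.2) := rfl

lemma q_of_fst_eq_zero (x : X.V₆) {w : S.W P} (hw : w.1 = 0) (w' : S.W P) :
    S.q P x w w' = S.coord x * (w.2 * w'.2) := by
  rw [q_apply, hw]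
  simp

lemma q_v (w w' : S.W P) :
    S.q P S.v w w' = -S.τ (wedge X.V₅ 3 2 5 rfl (S.lift w.1) (S.incl w'.1)) + w.2 * w'.2 := by
  rw [q_apply, S.toV₅_v, S.coord_v]
  simp

lemma q_symm (x : X.V₆) (w w' : S.W P) : S.q P x w w' = S.q P x w' w := by
  rw [q_apply, q_apply, wedge_vecWedge_comm, S.τ_lift_comm, mul_comm (w.2 : k)]

lemma q_coe (u : X.V₅) (w w' : S.W P) :
    S.q P u w w' =
      S.τ (vecWedge X.V₅ 4 5 rfl u (wedge X.V₅ 2 2 4 rfl (S.incl w.1) (S.incl w'.1))) := by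
  rw [q_apply, (S.coord_eq_zero_iff u).2 u.2, S.toV₅_coe, vecWedge_wedge, zero_mul, add_zero]

/-- The map `μ` of the GM data attached to `A`, with `W₁ = P`. -/
def μ : k ⊗[k] S.W P →ₗ[k] ⋀[k]^2 X.V₅ := S.proj P ∘ₗ (TensorProduct.lid k (S.W P)).toLinearMap

lemma μ_tmul (l : k) (w : S.W P) : S.μ P (l ⊗ₜ w) = l • S.incl w.1 := by
  rw [μ, LinearMap.comp_apply, LinearEquiv.coe_coe, TensorProduct.lid_tmul, map_smul]
  rfl

/-- The isomorphism `ε` of the GM data attached to `A`. -/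
def ε : ⋀[k]^5 X.V₅ ≃ₗ[k] k ⊗[k] k := S.τ.trans (TensorProduct.lid k k).symm

lemma ε_apply (z : ⋀[k]^5 X.V₅) : S.ε z = S.τ z • ((1 : k) ⊗ₜ[k] (1 : k)) := by
  rw [ε, LinearEquiv.trans_apply, TensorProduct.lid_symm_apply, ← tmul_smul, smul_eq_mul, mul_one]

lemma q_plucker (u : X.V₅) (l l' : k) (w w' : S.W P) :
    S.q P u w w' • (l ⊗ₜ[k] l') = S.ε (vecWedge X.V₅ 4 5 rfl u
      (wedge X.V₅ 2 2 4 rfl (S.μ P (l ⊗ₜ w)) (S.μ P (l' ⊗ₜ w')))) := by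
  have h : l ⊗ₜ[k] l' = (l * l') • ((1 : k) ⊗ₜ[k] (1 : k)) := by
    rw [← smul_tmul_smul, smul_eq_mul, smul_eq_mul, mul_one, mul_one]
  rw [q_coe, ε_apply, μ_tmul, μ_tmul, h, smul_smul]
  simp only [map_smul, LinearMap.smul_apply, smul_smul, smul_eq_mul]
  congr 1
  ring

/-- The GM data attached to `A`, with `W₁ = P`. -/
def gmData : GMData k where
  W := S.W P
  V₆ := X.V₆
  L := k
  V₅ := X.V₅
  finrank_V₆ := X.finrank_V₆
  finrank_V₅ := X.finrank_V₅
  finrank_L := Module.finrank_self k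
  μ := S.μ P
  q := S.q P
  ε := S.ε
  q_symm := S.q_symm P
  q_plucker := S.q_plucker P

lemma gmData_μAt (w : S.W P) : (S.gmData P).μAt (1 : k) w = S.incl w.1 := by
  change S.μ P ((1 : k) ⊗ₜ w) = _
  rw [μ_tmul, one_smul]

lemma gmData_mem_W₁ (w : S.W P) : w ∈ (S.gmData P).W₁ ↔ w.1 = 0 := by
  refine (GMData.mem_W₁_iff (D := S.gmData P) (one_ne_zero (α := k))).trans ⟨fun h => ?_,
    fun h => ?_⟩
  · exact (map_eq_zero_iff _ S.incl_injective).1 ((S.gmData_μAt P w).symm.trans h)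
  · exact (S.gmData_μAt P w).trans ((map_eq_zero_iff _ S.incl_injective).2 h)

lemma gmData_isOrdinary : (S.gmData P).IsOrdinary ↔ P = ⊥ := by
  rw [GMData.IsOrdinary, Submodule.eq_bot_iff, Submodule.eq_bot_iff]
  constructor
  · intro h x hx
    have := h ((0, ⟨x, hx⟩) : S.W P) ((S.gmData_mem_W₁ P _).2 rfl)
    exact congrArg (fun w : S.W P => (w.2 : k)) this
  · rintro h ⟨x, y, hy⟩ hw
    obtain rfl : x = 0 := (S.gmData_mem_W₁ P _).1 hw
    obtain rfl := h y hy
    rfl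

/-- A subspace P of k is 0 or k, which gives the ordinary and the special case respectively; one
construction covers both. -/
lemma gmData_isLci : (S.gmData P).IsLci := by
  rcases eq_bot_or_eq_top P with rfl | rfl
  · exact Or.inl ((S.gmData_isOrdinary ⊥).2 rfl)
  · refine Or.inr ⟨?_, fun x hx w hw hw0 => ?_⟩
    · let w : S.W ⊤ := (0, ⟨1, Submodule.mem_top⟩)
      have hw : w ∈ (S.gmData ⊤).W₁ := (S.gmData_mem_W₁ ⊤ w).2 rfl
      refine finrank_eq_one ⟨w, hw⟩ (fun h => ?_) fun x => ⟨((x.1 : S.W ⊤).2 : k), ?_⟩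
      · have h' : w = 0 := congrArg Subtype.val h
        exact one_ne_zero (congrArg (fun w : S.W ⊤ => (w.2 : k)) h')
      · refine Subtype.ext (Prod.ext ?_ (Subtype.ext ?_))
        · exact (smul_zero _).trans ((S.gmData_mem_W₁ ⊤ x.1).1 x.2).symm
        · exact mul_one _
    · have h1 : (w : S.W ⊤).1 = 0 := (S.gmData_mem_W₁ ⊤ w).1 hw
      have h2 : ((w : S.W ⊤).2 : k) ≠ 0 := fun h2 => hw0 (Prod.ext h1 (Subtype.ext h2))
      have hx' : S.coord x ≠ 0 := fun h => hx ((S.coord_eq_zero_iff x).1 h)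
      have h3 : (S.gmData ⊤).q x w w = _ := S.q_of_fst_eq_zero ⊤ x h1 w
      rw [h3]
      exact mul_ne_zero hx' (mul_ne_zero h2 h2)

/-- Both subspaces are Lagrangian, so it is enough that every point of the given A satisfies the
graph equation. -/
lemma gmData_A : (S.gmData P).A = X.A := by
  symm
  refine IsLagrangian.eq_of_le X.isLagrangian_A (S.gmData_isLci P).isLagrangian_A fun x hx => ?_
  rw [GMData.A_eq_graphLagrangian (D := S.gmData P) S.v_notMem (one_ne_zero (α := k)) S.ε_apply]
  obtain ⟨⟨ξ, η⟩, rfl⟩ := wedgeSplit_surjective X.finrank_V₆ X.finrank_V₅ S.v_notMem x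
  obtain ⟨a, rfl⟩ := S.exists_incl_eq ξ η hx
  let w : S.W P := (a, 0)
  have hw : w ∈ (S.gmData P).W₀ := by
    intro y w₁ hw₁
    have h1 : (w₁ : S.W P).1 = 0 := (S.gmData_mem_W₁ P w₁).1 hw₁
    exact (S.q_of_fst_eq_zero P y h1 w).trans (by simp [w])
  refine ⟨ξ, ⟨w, hw⟩, fun w' => ?_, ?_⟩
  · have key (b : S.W P) :
        S.τ (wedge X.V₅ 3 2 5 rfl ξ ((S.gmData P).μAt (1 : k) b)) + S.q P S.v w b = 0 := by
      rw [gmData_μAt, q_v]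
      -- The point and the chosen lift over the same bivector differ by an element of A in ⋀³V₅. Its
      -- orthogonality to the other lifts lets ξ replace `lift a` in the pairing.
      have h := (X.isLagrangian_A _).1 (X.A.sub_mem hx (S.lift_mem a)) _ (S.lift_mem b.1)
      rw [← map_sub, Prod.mk_sub_mk, sub_self,
        wedge_wedgeSplit_eq_zero_iff X.finrank_V₅ S.v_notMem S.τ] at h
      simp only [map_zero, map_sub, LinearMap.sub_apply] at h
      simp only [w, ZeroMemClass.coe_zero]
      linear_combination -h
    exact key w'.1
  · exact congrArg (fun η => wedgeSplit X.V₅ S.v (ξ, η)) (S.gmData_μAt P w)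

end Splitting

end LagrangianData

/-! ### Lagrangians in k ⊕ N for a line N -/

section OddLagrangian

variable {k : Type u} [Field k] {N : Type u} [AddCommGroup N] [Module k N]

lemma oddForm_apply (x y : k × N) : oddForm N x y = y.1 • x.2 - x.1 • y.2 := rfl

/-- The subspace `A` of `k ⊕ N`, where `N` is a line, is spanned by `(a, d)`. -/
def HasSlope (A : Submodule k (k × N)) (d : N) (a : k) : Prop :=
  ∀ z, z ∈ A ↔ ∃ s : k, z = (s * a, s • d)

lemma HasSlope.isLagrangian (hN : Module.finrank k N = 1) {A : Submodule k (k × N)} {d : N}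
    {a : k} (hd : d ≠ 0) (h : HasSlope A d a) : IsLagrangian (oddForm N) A := by
  rintro ⟨x, y⟩
  constructor
  · intro hx z hz
    obtain ⟨s, hs⟩ := (h _).1 hx
    obtain ⟨t, rfl⟩ := (h _).1 hz
    rw [hs, oddForm_apply]
    module
  · intro hx
    obtain ⟨e, he⟩ := exists_lineEquiv hN hd
    have h1 := hx (a, d) ((h _).2 ⟨1, by simp⟩)
    refine (h _).2 ⟨e y, Prod.ext ?_ (he y)⟩
    rw [oddForm_apply, he y, smul_smul, ← sub_smul, smul_eq_zero, or_iff_left hd, sub_eq_zero] at h1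
    exact h1.symm.trans (mul_comm _ _)

lemma HasSlope.ne_range_inl {A : Submodule k (k × N)} {d : N}
    {a : k} (hd : d ≠ 0) (h : HasSlope A d a) : A ≠ LinearMap.range (LinearMap.inl k k N) := by
  rintro rfl
  obtain ⟨x, hx⟩ := (h (a, d)).2 ⟨1, by simp⟩
  exact hd (congrArg Prod.snd hx).symm

lemma HasSlope.eq_range_inr_iff (hN : Module.finrank k N = 1) {A : Submodule k (k × N)} {d : N}
    {a : k} (hd : d ≠ 0) (h : HasSlope A d a) :
    A = LinearMap.range (LinearMap.inr k k N) ↔ a = 0 := by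
  constructor
  · rintro rfl
    obtain ⟨x, hx⟩ := (h (a, d)).2 ⟨1, by simp⟩
    exact (congrArg Prod.fst hx).symm
  · rintro rfl
    obtain ⟨e, he⟩ := exists_lineEquiv hN hd
    ext z
    rw [h z]
    constructor
    · rintro ⟨s, rfl⟩
      exact ⟨s • d, by simp⟩
    · rintro ⟨x, rfl⟩
      exact ⟨e x, by rw [← he]; simp⟩

lemma IsLagrangian.exists_hasSlope (hN : Module.finrank k N = 1) {A : Submodule k (k × N)}
    (hA : IsLagrangian (oddForm N) A) (hne : A ≠ LinearMap.range (LinearMap.inl k k N))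
    {d : N} (hd : d ≠ 0) : ∃ a, HasSlope A d a := by
  obtain ⟨e, he⟩ := exists_lineEquiv hN hd
  have h1 : ∃ z ∈ A, z.2 ≠ 0 := by
    by_contra! h
    -- If all second components vanished, A would lie in the isotropic line k ⊕ 0, and being its own
    -- orthogonal it would equal that line.
    refine hne (le_antisymm (fun z hz => ⟨z.1, Prod.ext rfl (h z hz).symm⟩) ?_)
    rintro _ ⟨x, rfl⟩
    refine (hA _).2 fun y hy => ?_
    rw [oddForm_apply, h y hy]
    simp
  obtain ⟨⟨x, y⟩, hz, hy⟩ := h1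
  have hey : e y ≠ 0 := e.map_ne_zero_iff.2 hy
  have hmem : (x / e y, d) ∈ A := by
    have h2 := A.smul_mem (e y)⁻¹ hz
    have h3 : (e y)⁻¹ • y = d := by rw [inv_smul_eq_iff₀ hey, ← he]
    rwa [Prod.smul_mk, smul_eq_mul, h3, inv_mul_eq_div] at h2
  refine ⟨x / e y, fun z => ⟨fun hz => ⟨e z.2, Prod.ext ?_ (he z.2)⟩, ?_⟩⟩
  · have h1 := (hA _).1 hz _ hmem
    rw [oddForm_apply, he z.2, smul_smul, ← sub_smul, smul_eq_zero, or_iff_left hd,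
      sub_eq_zero] at h1
    exact h1.symm.trans (mul_comm _ _)
  · rintro ⟨s, rfl⟩
    simpa using A.smul_mem s hmem

/-- The condition A₁ = 0 in terms of first components only; isomorphisms of extended data act as the
identity on these, so they preserve it. -/
lemma IsLagrangian.eq_range_inr_iff {A : Submodule k (k × N)} (hA : IsLagrangian (oddForm N) A) :
    A = LinearMap.range (LinearMap.inr k k N) ↔ ∀ z ∈ A, z.1 = 0 := by
  constructor
  · rintro rfl _ ⟨x, rfl⟩
    rfl
  · intro h
    refine le_antisymm (fun z hz => ⟨z.2, Prod.ext (h z hz).symm rfl⟩) ?_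
    rintro _ ⟨x, rfl⟩
    refine (hA _).2 fun y hy => ?_
    rw [oddForm_apply, h y hy]
    simp

lemma finrank_dual_quotient {V : Type u} [AddCommGroup V] [Module k V] {U : Submodule k V}
    (hV : Module.finrank k V = 6) (hU : Module.finrank k U = 5) :
    Module.finrank k (Module.Dual k (V ⧸ U)) = 1 := by
  have : FiniteDimensional k V := Module.finite_of_finrank_pos (by omega)
  have := U.finrank_quotient_add_finrank
  rw [Subspace.dual_finrank_eq]
  omega

lemma dual_apply_mkQ_ne_zero {V : Type u} [AddCommGroup V] [Module k V] {U : Submodule k V}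
    (hV : Module.finrank k V = 6) (hU : Module.finrank k U = 5) {f : Module.Dual k (V ⧸ U)}
    (hf : f ≠ 0) {v : V} (hv : v ∉ U) : f (U.mkQ v) ≠ 0 := by
  refine fun h => hf (LinearMap.ext fun x => ?_)
  obtain ⟨x, rfl⟩ := U.mkQ_surjective x
  obtain ⟨a, u, rfl⟩ := exists_eq_smul_add (by rw [hV, hU]) hv x
  have : U.mkQ (u : V) = 0 := by simp
  rw [map_add, this, add_zero, map_smul, map_smul, h, smul_zero, LinearMap.zero_apply]

end OddLagrangian

/-! ### The Lagrangian A₁ of an lci GM data -/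

namespace GMData

variable {k : Type u} [Field k] {D : GMData k}

lemma oddF₂_apply (μ₁ : D.W₁ →ₗ[k] k) (x : D.L) (z : D.V₆ ⊗[k] (D.L ⊗[k] D.W₁)) (w : D.W₁) :
    D.oddF₂ μ₁ (x, z) w = μ₁ w • x + D.oddF₂ μ₁ (0, z) w := by
  simp [oddF₂]

lemma oddF₂_zero_tmul (μ₁ : D.W₁ →ₗ[k] k) (v : D.V₆) (l : D.L) (w w' : D.W₁) :
    D.oddF₂ μ₁ (0, v ⊗ₜ (l ⊗ₜ w)) w' = D.q v w w' • l := by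
  simp [oddF₂, contraction_tmul]

lemma oddF₃_apply (μ₁ : D.W₁ →ₗ[k] k) (κ : D.L ≃ₗ[k] Module.Dual k (D.V₆ ⧸ D.V₅)) (x : D.L)
    (z : D.V₆ ⊗[k] (D.L ⊗[k] D.W₁)) :
    D.oddF₃ μ₁ κ (x, z) = (0, κ x) + D.oddF₃ μ₁ κ (0, z) := by
  simp [oddF₃]

lemma oddF₃_zero_tmul (μ₁ : D.W₁ →ₗ[k] k) (κ : D.L ≃ₗ[k] Module.Dual k (D.V₆ ⧸ D.V₅))
    (v : D.V₆) (l : D.L) (w : D.W₁) :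
    D.oddF₃ μ₁ κ (0, v ⊗ₜ (l ⊗ₜ w)) = (κ l (D.V₅.mkQ v) * μ₁ w, 0) := by
  simp [oddF₃]

lemma Iso.isOrdinary {E : GMData k} (f : Iso D E) (h : D.IsOrdinary) : E.IsOrdinary := by
  refine (Submodule.eq_bot_iff _).2 fun w hw => ?_
  obtain ⟨w, rfl⟩ := f.φW.surjective w
  rw [(Submodule.eq_bot_iff _).1 h w ((f.mem_W₁_iff w).1 hw), map_zero]

lemma IsOrdinary.subsingleton_W₁ (h : D.IsOrdinary) : Subsingleton D.W₁ := by
  rw [show D.W₁ = ⊥ from h]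
  infer_instance

lemma IsOrdinary.hasSlope_A₁ (h : D.IsOrdinary) (μ₁ : D.W₁ →ₗ[k] k)
    (κ : D.L ≃ₗ[k] Module.Dual k (D.V₆ ⧸ D.V₅)) {l : D.L} (hl : l ≠ 0) :
    HasSlope (D.A₁ μ₁ κ) (κ l) 0 := by
  have := h.subsingleton_W₁
  obtain ⟨e, he⟩ := exists_lineEquiv D.finrank_L hl
  intro z
  constructor
  · rintro ⟨⟨x, y⟩, -, rfl⟩
    obtain rfl : y = 0 := Subsingleton.elim _ _
    refine ⟨e x, ?_⟩
    rw [oddF₃_apply, Prod.mk_zero_zero, map_zero, ← map_smul, ← he, mul_zero, add_zero]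
  · rintro ⟨s, rfl⟩
    refine ⟨(s • l, 0), ?_, ?_⟩
    · refine LinearMap.ext fun w => ?_
      rw [Subsingleton.elim w 0, map_zero, map_zero]
    · rw [oddF₃_apply, Prod.mk_zero_zero, map_zero, ← map_smul, mul_zero, add_zero]

/-- With w normalised by μ₁(w) = 1, the kernel of g₂ imposes x' = -b q(v)(w, w) l on a tensor
equivalent to b v ⊗ l ⊗ w, and g₃ maps the solutions to a line. Its slope is nonzero because q(v)(w,
w) is finite and κ(l) does not vanish at v. -/
lemma IsSpecial.exists_hasSlope_A₁ (h : D.IsSpecial) {μ₁ : D.W₁ →ₗ[k] k}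
    (hμ₁ : Function.Injective μ₁) (κ : D.L ≃ₗ[k] Module.Dual k (D.V₆ ⧸ D.V₅)) {l : D.L}
    (hl : l ≠ 0) : ∃ a, a ≠ 0 ∧ HasSlope (D.A₁ μ₁ κ) (κ l) a := by
  obtain ⟨v, hv⟩ := D.exists_notMem_V₅
  have hsurj : Function.Surjective μ₁ :=
    (LinearMap.injective_iff_surjective_of_finrank_eq_finrank
      (by rw [h.1, Module.finrank_self])).1 hμ₁
  obtain ⟨w, hw⟩ := hsurj 1
  have hw0 : w ≠ 0 := by
    rintro rfl
    simp at hw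
  have hwt (w' : D.W₁) : w' = μ₁ w' • w := hμ₁ (by rw [map_smul, hw, smul_eq_mul, mul_one])
  have hq : D.q v w w ≠ 0 := h.2 v hv w w.2 fun h => hw0 (Subtype.ext h)
  have hκ : κ l (D.V₅.mkQ v) ≠ 0 :=
    dual_apply_mkQ_ne_zero D.finrank_V₆ D.finrank_V₅ (κ.map_ne_zero_iff.2 hl) hv
  -- Every tensor acts as a multiple of v ⊗ l ⊗ w: vectors of V₅ contribute neither to g₂, as q
  -- vanishes there on W₁, nor to g₃, as they die in V₆/V₅.
  have key (z : D.V₆ ⊗[k] (D.L ⊗[k] D.W₁)) : ∃ b : k,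
      D.oddF₃ μ₁ κ (0, z) = (b * κ l (D.V₅.mkQ v), 0) ∧
        D.oddF₂ μ₁ (0, z) w = (b * D.q v w w) • l := by
    induction z using TensorProduct.induction_on with
    | zero => exact ⟨0, by rw [Prod.mk_zero_zero, map_zero, zero_mul, Prod.mk_zero_zero], by
        rw [Prod.mk_zero_zero, map_zero]; simp⟩
    | add y z hy hz =>
      obtain ⟨b, hb, hb'⟩ := hy
      obtain ⟨c, hc, hc'⟩ := hz
      have : ((0 : D.L), y + z) = (0, y) + (0, z) := by simp
      refine ⟨b + c, ?_, ?_⟩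
      · rw [this, map_add, hb, hc, Prod.mk_add_mk, add_zero, add_mul]
      · rw [this, map_add, LinearMap.add_apply, hb', hc', add_mul, add_smul]
    | tmul x y =>
      obtain ⟨w', rfl⟩ := exists_eq_tmul_of_finrank_eq_one D.finrank_L hl y
      obtain ⟨a, u, rfl⟩ := D.exists_eq_smul_add_V₅ hv x
      refine ⟨a * μ₁ w', ?_, ?_⟩
      · have hu : D.V₅.mkQ (u : D.V₆) = 0 := by simp
        rw [oddF₃_zero_tmul, map_add, hu, add_zero, map_smul, map_smul, smul_eq_mul]
        congr 1
        ring
      · rw [oddF₂_zero_tmul, q_smul_add_W₁, hwt w']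
        simp only [Submodule.coe_smul, map_smul, LinearMap.smul_apply, smul_eq_mul, hw]
        congr 1
        ring
  refine ⟨-(κ l (D.V₅.mkQ v) / D.q v w w), neg_ne_zero.2 (div_ne_zero hκ hq), fun z => ?_⟩
  constructor
  · rintro ⟨⟨x, y⟩, hxy, rfl⟩
    obtain ⟨b, hb, hb'⟩ := key y
    have hx : D.oddF₂ μ₁ (x, y) w = 0 := LinearMap.congr_fun hxy w
    rw [oddF₂_apply, hw, one_smul, hb', add_eq_zero_iff_eq_neg, ← neg_smul] at hx
    subst hx
    refine ⟨-(b * D.q v w w), ?_⟩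
    rw [oddF₃_apply, hb, map_smul, Prod.mk_add_mk, zero_add, add_zero]
    congr 1
    field_simp
  · rintro ⟨s, rfl⟩
    refine ⟨(s • l, v ⊗ₜ (l ⊗ₜ (-(s / D.q v w w) • w))), ?_, ?_⟩
    · refine LinearMap.ext fun w' => ?_
      rw [oddF₂_apply, oddF₂_zero_tmul, hwt w', LinearMap.zero_apply, smul_smul, ← add_smul]
      refine smul_eq_zero_of_left ?_ _
      simp only [Submodule.coe_smul, map_smul, LinearMap.smul_apply, smul_eq_mul, hw]
      field_simp
      ring
    · rw [oddF₃_apply, oddF₃_zero_tmul, map_smul, Prod.mk_add_mk, zero_add, add_zero, map_smul, hw]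
      congr 1
      simp only [smul_eq_mul]
      field_simp

lemma IsLci.exists_hasSlope_A₁ (h : D.IsLci) {μ₁ : D.W₁ →ₗ[k] k}
    (hμ₁ : Function.Injective μ₁) (κ : D.L ≃ₗ[k] Module.Dual k (D.V₆ ⧸ D.V₅)) {l : D.L}
    (hl : l ≠ 0) : ∃ a, (D.IsOrdinary ↔ a = 0) ∧ HasSlope (D.A₁ μ₁ κ) (κ l) a := by
  by_cases hO : D.IsOrdinary
  · exact ⟨0, by simpa using hO, hO.hasSlope_A₁ μ₁ κ hl⟩
  · obtain ⟨a, ha, h'⟩ := (h.resolve_left hO).exists_hasSlope_A₁ hμ₁ κ hl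
    exact ⟨a, by simp [hO, ha], h'⟩

lemma IsLci.A₁_properties (h : D.IsLci) {μ₁ : D.W₁ →ₗ[k] k}
    (hμ₁ : Function.Injective μ₁) (κ : D.L ≃ₗ[k] Module.Dual k (D.V₆ ⧸ D.V₅)) :
    IsLagrangian (oddForm (Module.Dual k (D.V₆ ⧸ D.V₅))) (D.A₁ μ₁ κ) ∧
      D.A₁ μ₁ κ ≠ LinearMap.range (LinearMap.inl k k (Module.Dual k (D.V₆ ⧸ D.V₅))) ∧
      (D.IsOrdinary ↔
        D.A₁ μ₁ κ = LinearMap.range (LinearMap.inr k k (Module.Dual k (D.V₆ ⧸ D.V₅)))) := by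
  obtain ⟨l, hl⟩ := exists_ne_zero_of_finrank_eq_one D.finrank_L
  obtain ⟨a, ha, hs⟩ := h.exists_hasSlope_A₁ hμ₁ κ hl
  have hN := finrank_dual_quotient D.finrank_V₆ D.finrank_V₅
  have hd := κ.map_ne_zero_iff.2 hl
  exact ⟨hs.isLagrangian hN hd, hs.ne_range_inl hd, ha.trans (hs.eq_range_inr_iff hN hd).symm⟩

lemma IsLci.exists_injective (h : D.IsLci) : ∃ μ₁ : D.W₁ →ₗ[k] k, Function.Injective μ₁ := by
  by_cases hO : D.IsOrdinary
  · have := hO.subsingleton_W₁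
    exact ⟨0, Function.injective_of_subsingleton _⟩
  · obtain ⟨w, hw⟩ := exists_ne_zero_of_finrank_eq_one (h.finrank_W₁ hO)
    obtain ⟨e, -⟩ := exists_lineEquiv (h.finrank_W₁ hO) hw
    exact ⟨e.toLinearMap, e.injective⟩

lemma nonempty_κ (D : GMData k) : Nonempty (D.L ≃ₗ[k] Module.Dual k (D.V₆ ⧸ D.V₅)) :=
  have : FiniteDimensional k D.V₆ := Module.finite_of_finrank_pos (by rw [D.finrank_V₆]; norm_num)
  have : FiniteDimensional k D.L := Module.finite_of_finrank_pos (by rw [D.finrank_L]; norm_num)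
  ⟨LinearEquiv.ofFinrankEq _ _
    (D.finrank_L.trans (finrank_dual_quotient D.finrank_V₆ D.finrank_V₅).symm)⟩

end GMData

/-! ### Isomorphisms of extended Lagrangian data -/

namespace ExtLagrangianData

variable {k : Type u} [Field k]

lemma Iso.eq_range_inr_iff {D E : ExtLagrangianData k} (f : Iso D E) :
    D.A₁ = LinearMap.range (LinearMap.inr k k (Module.Dual k (D.V₆ ⧸ D.V₅))) ↔
      E.A₁ = LinearMap.range (LinearMap.inr k k (Module.Dual k (E.V₆ ⧸ E.V₅))) := by
  rw [D.isLagrangian_A₁.eq_range_inr_iff, E.isLagrangian_A₁.eq_range_inr_iff, ← f.map_A₁]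
  constructor
  · rintro h _ ⟨z, hz, rfl⟩
    exact h z hz
  · intro h z hz
    exact h _ (Submodule.mem_map_of_mem hz)

/-- Extended Lagrangian data of the same type with isomorphic Lagrangian data are isomorphic. -/
lemma nonempty_iso {D E : ExtLagrangianData k} (hD : D.NeInfinity) (hE : E.NeInfinity)
    (h : D.A₁ = LinearMap.range (LinearMap.inr k k (Module.Dual k (D.V₆ ⧸ D.V₅))) ↔
      E.A₁ = LinearMap.range (LinearMap.inr k k (Module.Dual k (E.V₆ ⧸ E.V₅))))
    (φ : D.V₆ ≃ₗ[k] E.V₆) (hV : D.V₅.map (φ : D.V₆ →ₗ[k] E.V₆) = E.V₅)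
    (hA : D.A.map (exteriorPower.map 3 (φ : D.V₆ →ₗ[k] E.V₆)) = E.A) : Nonempty (Iso D E) := by
  have hDN := finrank_dual_quotient D.finrank_V₆ D.finrank_V₅
  have hEN := finrank_dual_quotient E.finrank_V₆ E.finrank_V₅
  obtain ⟨d, hd⟩ := exists_ne_zero_of_finrank_eq_one hDN
  let ψ := (Submodule.Quotient.equiv D.V₅ E.V₅ φ hV).symm.dualMap
  have hd' : ψ d ≠ 0 := ψ.map_ne_zero_iff.2 hd
  obtain ⟨a, ha⟩ := D.isLagrangian_A₁.exists_hasSlope hDN hD hd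
  obtain ⟨b, hb⟩ := E.isLagrangian_A₁.exists_hasSlope hEN hE hd'
  rw [ha.eq_range_inr_iff hDN hd, hb.eq_range_inr_iff hEN hd'] at h
  -- Acting by t on the second summand divides the slope by t. Two slopes that are both zero or both
  -- nonzero can therefore be matched.
  obtain ⟨t, ht⟩ : ∃ t : kˣ, t * b = a := by
    by_cases h0 : a = 0
    · exact ⟨1, by rw [h0, h.1 h0, mul_zero]⟩
    · have hb0 : b ≠ 0 := fun hb0 => h0 (h.2 hb0)
      exact ⟨Units.mk0 (a / b) (div_ne_zero h0 hb0), div_mul_cancel₀ a hb0⟩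
  have hodd (s : k) : oddMap φ D.V₅ E.V₅ hV t (s * a, s • d) = ((s * t) * b, (s * t) • ψ d) := by
    refine Prod.ext ?_ ?_
    · change s * a = _
      rw [mul_assoc, ht]
    · change (t : k) • ψ (s • d) = _
      rw [map_smul, smul_smul, mul_comm]
  refine ⟨⟨φ, t, hV, hA, ?_⟩⟩
  ext z
  constructor
  · rintro ⟨y, hy, rfl⟩
    obtain ⟨s, rfl⟩ := (ha y).1 hy
    exact (hb _).2 ⟨_, hodd s⟩
  · intro hz
    obtain ⟨s, rfl⟩ := (hb z).1 hz
    refine ⟨_, (ha _).2 ⟨s * (t⁻¹ : kˣ), rfl⟩, ?_⟩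
    rw [hodd, Units.inv_mul_cancel_right]

end ExtLagrangianData

/-! ### Isomorphism classes -/

section IsoClasses

variable {k : Type u} [Field k]

lemma isoClass_eq_iff {C : Type*} [Category C] {X Y : C} :
    isoClass X = isoClass Y ↔ Nonempty (X ≅ Y) :=
  ⟨fun h => Quotient.exact h, fun h => Quotient.sound h⟩

lemma LciGMData.nonempty_iso_iff {D E : LciGMData k} :
    Nonempty (D ≅ E) ↔ Nonempty (GMData.Iso D.obj E.obj) :=
  ⟨fun ⟨e⟩ => ⟨e.hom.hom⟩,
    fun ⟨f⟩ => ⟨ObjectProperty.isoMk _ ((Groupoid.isoEquivHom D.obj E.obj).symm f)⟩⟩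

lemma OrdinaryGMData.nonempty_iso_iff {D E : OrdinaryGMData k} :
    Nonempty (D ≅ E) ↔ Nonempty (GMData.Iso D.obj E.obj) :=
  ⟨fun ⟨e⟩ => ⟨e.hom.hom⟩,
    fun ⟨f⟩ => ⟨ObjectProperty.isoMk _ ((Groupoid.isoEquivHom D.obj E.obj).symm f)⟩⟩

lemma FiniteExtLagrangianData.nonempty_iso_iff {D E : FiniteExtLagrangianData k} :
    Nonempty (D ≅ E) ↔ Nonempty (ExtLagrangianData.Iso D.obj E.obj) :=
  ⟨fun ⟨e⟩ => ⟨e.hom.hom⟩,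
    fun ⟨f⟩ => ⟨ObjectProperty.isoMk _ ((Groupoid.isoEquivHom D.obj E.obj).symm f)⟩⟩

lemma LagrangianData.nonempty_iso_iff {D E : LagrangianData k} :
    Nonempty (D ≅ E) ↔ Nonempty (LagrangianData.Iso D E) :=
  ⟨fun ⟨e⟩ => ⟨e.hom⟩, fun ⟨f⟩ => ⟨(Groupoid.isoEquivHom D E).symm f⟩⟩

end IsoClasses

end GushelMukai

end

/-! ### The theorem -/

theorem theorem3p6 (k : Type u) [Field k] :
    ∃ (hA : ∀ D : LciGMData k, IsLagrangian (wedge D.obj.V₆ 3 3 6 rfl) D.obj.A)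
      (hφ : ∀ {D E : LciGMData k} (f : D ⟶ E),
        D.obj.A.map (exteriorPower.map 3 (f.hom.φV : D.obj.V₆ →ₗ[k] E.obj.V₆)) = E.obj.A),
      Function.Bijective
        (mapIsoClasses (ordinaryToLci k ⋙ lagrangianFunctor hA hφ)) ∧
      ((∀ a : k, IsSquare a) →
        ∃ (hA₁ : ∀ (D : LciGMData k) (μ₁ : D.obj.W₁ →ₗ[k] k)
            (κ : D.obj.L ≃ₗ[k] Module.Dual k (D.obj.V₆ ⧸ D.obj.V₅)), Function.Injective μ₁ →
            IsLagrangian (oddForm (Module.Dual k (D.obj.V₆ ⧸ D.obj.V₅))) (D.obj.A₁ μ₁ κ))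
          (hne : ∀ (D : LciGMData k) (μ₁ : D.obj.W₁ →ₗ[k] k)
            (κ : D.obj.L ≃ₗ[k] Module.Dual k (D.obj.V₆ ⧸ D.obj.V₅)), Function.Injective μ₁ →
            D.obj.A₁ μ₁ κ ≠
              LinearMap.range (LinearMap.inl k k (Module.Dual k (D.obj.V₆ ⧸ D.obj.V₅))))
          (Φ : IsoClasses (LciGMData k) → IsoClasses (FiniteExtLagrangianData k)),
          (∀ (D : LciGMData k) (μ₁ : D.obj.W₁ →ₗ[k] k)
            (κ : D.obj.L ≃ₗ[k] Module.Dual k (D.obj.V₆ ⧸ D.obj.V₅)) (hμ₁ : Function.Injective μ₁),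
            Φ (isoClass D) = isoClass
              (extLagrangianData D (hA D) μ₁ κ (hA₁ D μ₁ κ hμ₁) (hne D μ₁ κ hμ₁))) ∧
          (∀ (D : LciGMData k) (μ₁ : D.obj.W₁ →ₗ[k] k)
            (κ : D.obj.L ≃ₗ[k] Module.Dual k (D.obj.V₆ ⧸ D.obj.V₅)), Function.Injective μ₁ →
            (D.obj.IsOrdinary ↔ D.obj.A₁ μ₁ κ =
              LinearMap.range (LinearMap.inr k k (Module.Dual k (D.obj.V₆ ⧸ D.obj.V₅))))) ∧
          mapIsoClasses (forgetA₁ k) ∘ Φ = mapIsoClasses (lagrangianFunctor hA hφ) ∧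
          Function.Bijective Φ) := by
  have hA : ∀ D : LciGMData k, IsLagrangian (wedge D.obj.V₆ 3 3 6 rfl) D.obj.A :=
    fun D => D.property.isLagrangian_A
  have hφ : ∀ {D E : LciGMData k} (f : D ⟶ E),
      D.obj.A.map (exteriorPower.map 3 (f.hom.φV : D.obj.V₆ →ₗ[k] E.obj.V₆)) = E.obj.A :=
    fun f => GMData.Iso.map_A f.hom
  refine ⟨hA, hφ, ⟨?_, ?_⟩, fun hk => ?_⟩
  · rintro ⟨D⟩ ⟨E⟩ h
    obtain ⟨f⟩ := LagrangianData.nonempty_iso_iff.1 (isoClass_eq_iff.1 h)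
    exact isoClass_eq_iff.2 (OrdinaryGMData.nonempty_iso_iff.2
      (GMData.nonempty_iso_of_isOrdinary D.property E.property f.φ f.map_V₅ f.map_A))
  · rintro ⟨X⟩
    obtain ⟨S⟩ := X.nonempty_splitting
    refine ⟨isoClass ⟨S.gmData ⊥, (S.gmData_isOrdinary ⊥).2 rfl⟩, isoClass_eq_iff.2
      (LagrangianData.nonempty_iso_iff.2 ⟨⟨LinearEquiv.refl k X.V₆, ?_, ?_⟩⟩)⟩
    · exact Submodule.map_id _
    · exact (wedge_map_refl _).trans (S.gmData_A ⊥)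
  · have hA₁ : ∀ (D : LciGMData k) (μ₁ : D.obj.W₁ →ₗ[k] k)
        (κ : D.obj.L ≃ₗ[k] Module.Dual k (D.obj.V₆ ⧸ D.obj.V₅)), Function.Injective μ₁ →
        IsLagrangian (oddForm (Module.Dual k (D.obj.V₆ ⧸ D.obj.V₅))) (D.obj.A₁ μ₁ κ) :=
      fun D _ κ hμ₁ => (D.property.A₁_properties hμ₁ κ).1
    have hne : ∀ (D : LciGMData k) (μ₁ : D.obj.W₁ →ₗ[k] k)
        (κ : D.obj.L ≃ₗ[k] Module.Dual k (D.obj.V₆ ⧸ D.obj.V₅)), Function.Injective μ₁ →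
        D.obj.A₁ μ₁ κ ≠
          LinearMap.range (LinearMap.inl k k (Module.Dual k (D.obj.V₆ ⧸ D.obj.V₅))) :=
      fun D _ κ hμ₁ => (D.property.A₁_properties hμ₁ κ).2.1
    have hord : ∀ (D : LciGMData k) (μ₁ : D.obj.W₁ →ₗ[k] k)
        (κ : D.obj.L ≃ₗ[k] Module.Dual k (D.obj.V₆ ⧸ D.obj.V₅)), Function.Injective μ₁ →
        (D.obj.IsOrdinary ↔ D.obj.A₁ μ₁ κ =
          LinearMap.range (LinearMap.inr k k (Module.Dual k (D.obj.V₆ ⧸ D.obj.V₅)))) :=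
      fun D _ κ hμ₁ => (D.property.A₁_properties hμ₁ κ).2.2
    choose μ₁ hμ₁ using fun D : LciGMData k => D.property.exists_injective
    let κ (D : LciGMData k) := D.obj.nonempty_κ.some
    let G (D : LciGMData k) : FiniteExtLagrangianData k :=
      extLagrangianData D (hA D) (μ₁ D) (κ D) (hA₁ D _ _ (hμ₁ D)) (hne D _ _ (hμ₁ D))
    -- The type (ordinary or special) and the Lagrangian data already determine the class. This
    -- gives both the invariance of Φ under isomorphism and, for f the identity, its independence of
    -- μ₁ and κ.
    have hG (D E : LciGMData k) (f : GMData.Iso D.obj E.obj) (m : E.obj.W₁ →ₗ[k] k)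
        (c : E.obj.L ≃ₗ[k] Module.Dual k (E.obj.V₆ ⧸ E.obj.V₅)) (hm : Function.Injective m) :
        isoClass (G D) =
          isoClass (extLagrangianData E (hA E) m c (hA₁ E m c hm) (hne E m c hm)) := by
      refine isoClass_eq_iff.2 (FiniteExtLagrangianData.nonempty_iso_iff.2
        (ExtLagrangianData.nonempty_iso (G D).property (hne E m c hm) ?_ f.φV f.map_V₅ f.map_A))
      exact (hord D _ _ (hμ₁ D)).symm.trans
        (Iff.trans ⟨f.isOrdinary, f.symm.isOrdinary⟩ (hord E m c hm))
    let Φ : IsoClasses (LciGMData k) → IsoClasses (FiniteExtLagrangianData k) :=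
      Quotient.lift (fun D => isoClass (G D)) fun D E h => by
        obtain ⟨f⟩ := LciGMData.nonempty_iso_iff.1 h
        exact hG D E f _ _ (hμ₁ E)
    refine ⟨hA₁, hne, Φ, fun D m c hm => hG D D (GMData.Iso.refl D.obj) m c hm, hord, ?_, ?_, ?_⟩
    · funext x
      obtain ⟨D⟩ := x
      rfl
    · rintro ⟨D⟩ ⟨E⟩ h
      obtain ⟨f⟩ := FiniteExtLagrangianData.nonempty_iso_iff.1 (isoClass_eq_iff.1 h)
      refine isoClass_eq_iff.2 (LciGMData.nonempty_iso_iff.2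
        (GMData.nonempty_iso_of_isLci hk D.property E.property ?_ f.φ f.map_V₅ f.map_A))
      exact (hord D _ _ (hμ₁ D)).trans (f.eq_range_inr_iff.trans (hord E _ _ (hμ₁ E)).symm)
    · rintro ⟨X⟩
      obtain ⟨S⟩ := X.obj.toLagrangianData.nonempty_splitting
      -- P records the one bit that A₁ adds to A: W₁ is taken to be zero or a line accordingly.
      obtain ⟨P, hP⟩ : ∃ P : Submodule k k, P = ⊥ ↔ X.obj.A₁ =
          LinearMap.range (LinearMap.inr k k (Module.Dual k (X.obj.V₆ ⧸ X.obj.V₅))) := by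
        by_cases h : X.obj.A₁ =
          LinearMap.range (LinearMap.inr k k (Module.Dual k (X.obj.V₆ ⧸ X.obj.V₅)))
        · exact ⟨⊥, by simp [h]⟩
        · exact ⟨⊤, by simp [h]⟩
      let D : LciGMData k := ⟨S.gmData P, S.gmData_isLci P⟩
      refine ⟨isoClass D, isoClass_eq_iff.2 (FiniteExtLagrangianData.nonempty_iso_iff.2
        (ExtLagrangianData.nonempty_iso (G D).property X.property ?_
          (LinearEquiv.refl k X.obj.V₆) ?_ ?_))⟩
      · exact (hord D _ _ (hμ₁ D)).symm.trans ((S.gmData_isOrdinary P).trans hP)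
      · exact Submodule.map_id _
      · exact (wedge_map_refl _).trans (S.gmData_A P)
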